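/- A predominated graph is a pair $(G,D)$ of a finite graph $G$ and a set $D\subseteq V(G)$. In the Maker-Breaker domination game on $(G,D)$, Staller and Dominator alternately claim unclaimed vertices of $G$, Staller moving first. Dominator wins if the vertices he claims dominate every vertex of $V(G)\setminus D$; Staller wins if she claims all vertices of the closed neighbourhood $N[v]$ of some $v\in V(G)\setminus D$. The pair $(G,D)$ is MBD critical if Staller has a winning strategy on $(G,D)$, but Dominator has a winning strategy on $(G,D\cup\{v\})$ for every $v\in V(G)\setminus D$. Theorem. It can be decided in linear time whether a given predominated tree is MBD critical: there are a random access machine program and a constant $c$ such that for every tree $T$ with vertex set $\{0,\dots,n-1\}$ and every $D\subseteq V(T)$, given $n$, the indicator vector of $D$ and the list of the edges of $T$ (in any order, each with its ends in any order), the program halts after at most $cn$ elementary steps, uses only numbers that are at most $cn$, and answers correctly whether $(T,D)$ is MBD critical. Moreover, for every finite tree $T$ and every $D\subseteq V(T)$, with $X=V(T)\setminus D$ and $T'=T\big[\bigcup_{x\in X}N[x]\big]$, the pair $(T,D)$ is MBD critical if and only if $T'$ is connected (in particular, it has at least one vertex), $X$ is one of the two classes of the bipartition of $T'$, and every vertex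 of the other class has degree $2$ in $T'$. -/

import Mathlib

namespace MBD

/-! ### The Maker-Breaker domination game on a predominated graph -/

section Game

variable {V : Type*} [DecidableEq V]

/-- The closed neighbourhood `N[v]`. -/
def closedNbhd (G : SimpleGraph V) (v : V) : Set V :=
  insert v (G.neighborSet v)

/-- Two players alternately claim unclaimed vertices until the board is exhausted.
`CanForce goal myTurn A B` says that the player who has claimed the set `A` so far, while the
opponent has claimed `B`, has a strategy which guarantees that at some moment the set of vertices
claimed by her satisfies `goal`; `myTurn` tells whether she is the one to move. -/
inductive CanForce (goal : Finset V → Prop) : Bool → Finset V → Finset V → Prop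
  | achieved (myTurn : Bool) (A B : Finset V) : goal A → CanForce goal myTurn A B
  | myMove (A B : Finset V) (v : V) : v ∉ A → v ∉ B →
      CanForce goal false (insert v A) B → CanForce goal true A B
  | opponentMove (A B : Finset V) : (∃ v, v ∉ A ∧ v ∉ B) →
      (∀ v, v ∉ A → v ∉ B → CanForce goal true A (insert v B)) → CanForce goal false A B

/-- Staller, who moves first, can claim a whole closed neighbourhood of a vertex outside `D`. -/
def StallerWins (G : SimpleGraph V) (D : Finset V) : Prop :=
  CanForce (fun A : Finset V => ∃ v, v ∉ D ∧ closedNbhd G v ⊆ (A : Set V)) true ∅ ∅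

/-- Dominator, who moves second, can claim vertices that dominate all vertices outside `D`. -/
def DominatorWins (G : SimpleGraph V) (D : Finset V) : Prop :=
  CanForce (fun A : Finset V => ∀ v, v ∉ D → ∃ u ∈ A, u ∈ closedNbhd G v) false ∅ ∅

/-- `(G, D)` is Maker-Breaker domination game critical. -/
def Critical (G : SimpleGraph V) (D : Finset V) : Prop :=
  StallerWins G D ∧ ∀ v, v ∉ D → DominatorWins G (insert v D)

end Game

/-! ### The structural test -/

section Criterion

variable {V : Type*}

/-- The set `⋃_{x ∉ D} N[x]`. -/
def testVerts (G : SimpleGraph V) (D : Finset V) : Set V :=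
  {u | ∃ x, x ∉ D ∧ u ∈ closedNbhd G x}

/-- `H` has bipartition `(A, B)`. -/
def IsBipartition {W : Type*} (H : SimpleGraph W) (A B : Set W) : Prop :=
  A ∪ B = Set.univ ∧ H.IsBipartiteWith A B

/-- With `X = V \ D` and `T' = G[⋃_{x ∈ X} N[x]]`: the graph `T'` is connected (in particular it has
a vertex), `X` is one class of its bipartition, and all vertices of the other class have
degree `2` in `T'`. -/
def PassesTest (G : SimpleGraph V) (D : Finset V) : Prop :=
  (G.induce (testVerts G D)).Connected ∧
    ∃ V₀ V₁ : Set (testVerts G D), IsBipartition (G.induce (testVerts G D)) V₀ V₁ ∧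
      Subtype.val '' V₀ = {x : V | x ∉ D} ∧
      ∀ y ∈ V₁, ((G.induce (testVerts G D)).neighborSet y).ncard = 2

end Criterion

/-! ### Random access machines

Programs are structured (`while`-) programs of a random access machine with finitely many used
registers and one memory array, all of whose cells hold natural numbers. The machine can add,
subtract (truncated at `0`), read and write memory at computed addresses, and test for `≠ 0`; each
of these elementary operations costs one unit of time. All numbers that occur during the execution
have to be at most the word bound `W`; otherwise the execution is undefined. -/

/-- A state of the machine: contents of the registers and of the memory cells. -/
structure State where
  reg : ℕ → ℕ
  mem : ℕ → ℕ

inductive Expr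
  | const (k : ℕ)
  | reg (r : ℕ)
  | load (address : Expr)
  | add (e f : Expr)
  | sub (e f : Expr)

namespace Expr

def eval (s : State) : Expr → ℕ
  | const k => k
  | reg r => s.reg r
  | load a => s.mem (a.eval s)
  | add e f => e.eval s + f.eval s
  | sub e f => e.eval s - f.eval s

/-- Number of elementary operations for the evaluation. -/
def cost : Expr → ℕ
  | const _ => 1
  | reg _ => 1
  | load a => a.cost + 1
  | add e f => e.cost + f.cost + 1
  | sub e f => e.cost + f.cost + 1

/-- All values occurring in the evaluation, including those used as addresses, are at most `W`. -/
def Fits (W : ℕ) (s : State) : Expr → Prop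
  | const k => k ≤ W
  | reg r => s.reg r ≤ W
  | load a => a.Fits W s ∧ s.mem (a.eval s) ≤ W
  | add e f => e.Fits W s ∧ f.Fits W s ∧ e.eval s + f.eval s ≤ W
  | sub e f => e.Fits W s ∧ f.Fits W s

end Expr

inductive Prog
  | skip
  | assign (r : ℕ) (e : Expr)
  | store (address value : Expr)
  | seq (P Q : Prog)
  | cond (test : Expr) (P Q : Prog)
  | loop (test : Expr) (P : Prog)

/-- `Exec W P s t s'`: started in the state `s`, the program `P` halts in the state `s'` after
exactly `t` units of time, all occurring numbers being at most `W`. -/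
inductive Exec (W : ℕ) : Prog → State → ℕ → State → Prop
  | skip (s : State) : Exec W .skip s 1 s
  | assign (s : State) (r : ℕ) (e : Expr) : e.Fits W s →
      Exec W (.assign r e) s (e.cost + 1) ⟨Function.update s.reg r (e.eval s), s.mem⟩
  | store (s : State) (a e : Expr) : a.Fits W s → e.Fits W s →
      Exec W (.store a e) s (a.cost + e.cost + 1)
        ⟨s.reg, Function.update s.mem (a.eval s) (e.eval s)⟩
  | seq (P Q : Prog) (s s₁ s₂ : State) (t₁ t₂ : ℕ) : Exec W P s t₁ s₁ → Exec W Q s₁ t₂ s₂ →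
      Exec W (.seq P Q) s (t₁ + t₂) s₂
  | condTrue (e : Expr) (P Q : Prog) (s s' : State) (t : ℕ) : e.Fits W s → e.eval s ≠ 0 →
      Exec W P s t s' → Exec W (.cond e P Q) s (e.cost + 1 + t) s'
  | condFalse (e : Expr) (P Q : Prog) (s s' : State) (t : ℕ) : e.Fits W s → e.eval s = 0 →
      Exec W Q s t s' → Exec W (.cond e P Q) s (e.cost + 1 + t) s'
  | loopTrue (e : Expr) (P : Prog) (s s₁ s₂ : State) (t₁ t₂ : ℕ) : e.Fits W s → e.eval s ≠ 0 →
      Exec W P s t₁ s₁ → Exec W (.loop e P) s₁ t₂ s₂ →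
      Exec W (.loop e P) s (e.cost + 1 + t₁ + t₂) s₂
  | loopFalse (e : Expr) (P : Prog) (s : State) : e.Fits W s → e.eval s = 0 →
      Exec W (.loop e P) s (e.cost + 1) s

/-- The initial state for an input word: the word is in the first memory cells, everything else
is `0`. -/
def initState (w : List ℕ) : State where
  reg := fun _ => 0
  mem := fun i => w.getD i 0

/-- `w` represents the predominated graph `(G, D)` on the vertices `0, …, n - 1`: it consists of `n`,
the indicator vector of `D`, and a list of the edges, in an arbitrary order and each of them
exactly once, an edge being given by its two ends, in an arbitrary order. -/
def Represents {n : ℕ} (w : List ℕ) (G : SimpleGraph (Fin n)) (D : Finset (Fin n)) : Prop :=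
  ∃ es : List (Fin n × Fin n),
    (es.map fun p => s(p.1, p.2)).Nodup ∧
    (∀ e : Sym2 (Fin n), e ∈ es.map (fun p => s(p.1, p.2)) ↔ e ∈ G.edgeSet) ∧
    w = n :: (List.ofFn fun v : Fin n => if v ∈ D then 1 else 0) ++
      es.flatMap fun p => [(p.1 : ℕ), (p.2 : ℕ)]

/-- The program `P` decides whether a predominated tree is critical, in linear time: there is a
constant `c` such that on every representation of a predominated tree with `n` vertices it halts
within `c * n` units of time, using only numbers up to `c * n`, with the answer (`1` for yes,
`0` for no) in register `0`. -/
def DecidesCriticalTreesInLinearTime (P : Prog) : Prop :=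
  ∃ c : ℕ, ∀ (n : ℕ) (T : SimpleGraph (Fin n)) (D : Finset (Fin n)) (w : List ℕ),
    T.IsTree → Represents w T D →
    ∃ (t : ℕ) (s : State), Exec (c * n) P (initState w) t s ∧ t ≤ c * n ∧
      (Critical T D → s.reg 0 = 1) ∧ (¬ Critical T D → s.reg 0 = 0)

end MBD

/-! Let X be the complement of D. In every finite forest, criticality, the structural test and the
numerical conditions `CountTest` are equivalent; the last can be checked by one pass over the edges
and one over the vertices.

If the test holds, T' is a tree on which X forms one class and the other class Y has only vertices
of degree 2, so counting edges gives |X| = |Y| + 1. Staller wins by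
`canForce_closedNbhd_of_card_lt`: some x in X has at most one free neighbour; she claims it,
Dominator must answer at x, and the surplus of X over Y persists. If v is added to D, then sending
every other x in X one step towards v is injective because Y has degree 2; this matching is a
pairing strategy for Dominator.

Conversely, colour the forest with two colours. If both colour classes of X satisfy Hall's
condition, the two injections can be merged into a matching that covers X
(`dominatorWins_of_injOn`), and Dominator wins. So a win of Staller yields a violator of Hall's
condition inside one class, and a minimal one, S, satisfies `CountTest` with the complement of S as
predominated set (`exists_countTest_of_card_lt`). Staller wins even if only S has to be dominated,
so criticality forces S = X. -/

namespace MBD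

/-! ### Strategies: determinacy, pairings, and Staller's forcing sequence -/

section Games

variable {V : Type*} [DecidableEq V]

/-- A goal reached by one player stays reached as her set grows, and the claimed sets stay disjoint,
so the other player can never reach an incompatible goal. -/
theorem not_canForce_of_blocked {goal goal' : Finset V → Prop}
    (hmono : ∀ A A' : Finset V, A ⊆ A' → goal A → goal A')
    (hexcl : ∀ A B, Disjoint A B → goal A → ¬ goal' B) {t : Bool} {B A : Finset V}
    (h : CanForce goal' t B A) (hd : Disjoint A B) : ¬ goal A := by
  induction h with
  | achieved t B A hB => exact fun hA => hexcl A B hd hA hB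
  | myMove B A v hvB hvA _ ih =>
    exact ih (by simp [hd, hvA])
  | opponentMove B A hfree _ ih =>
    intro hA
    obtain ⟨v, hvB, hvA⟩ := hfree
    exact ih v hvB hvA (by simp [hd, hvB]) (hmono _ _ (Finset.subset_insert v A) hA)

/-- The two strategies are played against each other; whichever goal comes first excludes the other.
-/
theorem CanForce.not_opponent {goal goal' : Finset V → Prop}
    (hmono : ∀ A A' : Finset V, A ⊆ A' → goal A → goal A')
    (hmono' : ∀ A A' : Finset V, A ⊆ A' → goal' A → goal' A')
    (hexcl : ∀ A B, Disjoint A B → goal A → ¬ goal' B) {t : Bool} {A B : Finset V}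
    (h : CanForce goal t A B) (hd : Disjoint A B) : ¬ CanForce goal' (!t) B A := by
  induction h with
  | achieved t A B hA =>
    exact fun h' => not_canForce_of_blocked hmono hexcl h' hd hA
  | myMove A B v hvA hvB h ih =>
    intro h'
    cases h' with
    | achieved _ _ _ hB =>
      exact not_canForce_of_blocked hmono' (fun A B hAB hA hB => hexcl B A hAB.symm hB hA)
        (CanForce.myMove A B v hvA hvB h) hd.symm hB
    | opponentMove _ _ _ h' =>
      exact ih (by simp [hd, hvB]) (h' v hvB hvA)
  | opponentMove A B hfree h ih =>
    intro h'
    cases h' with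
    | achieved _ _ _ hB =>
      exact not_canForce_of_blocked hmono' (fun A B hAB hA hB => hexcl B A hAB.symm hB hA)
        (CanForce.opponentMove A B hfree h) hd.symm hB
    | myMove _ _ v hvB hvA h' =>
      exact ih v hvA hvB (by simp [hd, hvA]) h'

theorem CanForce.mono {goal goal' : Finset V → Prop} (hgoal : ∀ A, goal A → goal' A)
    {t : Bool} {A B : Finset V} (h : CanForce goal t A B) : CanForce goal' t A B := by
  induction h with
  | achieved t A B hA => exact .achieved t A B (hgoal A hA)
  | myMove A B v hvA hvB _ ih => exact .myMove A B v hvA hvB ih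
  | opponentMove A B hfree _ ih => exact .opponentMove A B hfree ih

theorem StallerWins.anti {G : SimpleGraph V} {D D' : Finset V} (hD : D' ⊆ D)
    (h : StallerWins G D) : StallerWins G D' :=
  CanForce.mono (fun _ ⟨v, hv, hA⟩ => ⟨v, fun h => hv (hD h), hA⟩) h

theorem StallerWins.not_dominatorWins {G : SimpleGraph V} {D : Finset V}
    (h : StallerWins G D) : ¬ DominatorWins G D := by
  refine CanForce.not_opponent ?_ ?_ ?_ h (Finset.disjoint_empty_left _)
  · rintro A A' hAA' ⟨v, hv, hA⟩
    exact ⟨v, hv, hA.trans (Finset.coe_subset.2 hAA')⟩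
  · intro A A' hAA' hA v hv
    obtain ⟨u, hu, huv⟩ := hA v hv
    exact ⟨u, hAA' hu, huv⟩
  · rintro A B hd ⟨v, hv, hA⟩ hB
    obtain ⟨u, hu, huv⟩ := hB v hv
    exact Finset.disjoint_left.1 hd (Finset.mem_coe.1 (hA huv)) hu

theorem mem_closedNbhd {V : Type*} {G : SimpleGraph V} {u v : V} :
    u ∈ closedNbhd G v ↔ u = v ∨ G.Adj v u := by
  simp [closedNbhd]

/-- The pairing strategy. -/
theorem dominatorWins_of_pairing [Fintype V] {G : SimpleGraph V} {D : Finset V} (m : V → V)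
    (hinv : ∀ v, m (m v) = v)
    (hcov : ∀ v, v ∉ D → ∃ u ∈ closedNbhd G v, m u ∈ closedNbhd G v ∧ m u ≠ u) :
    DominatorWins G D := by
  -- Invariant before Staller's move: the partner of each of her vertices belongs to Dominator. The
  -- count of free vertices is only bounded by `k`, since a round uses up one or two of them.
  suffices H : ∀ k (A B : Finset V), ((A ∪ B)ᶜ).card ≤ k → (∀ u ∈ B, m u ≠ u → m u ∈ A) →
      CanForce (fun A : Finset V => ∀ v, v ∉ D → ∃ u ∈ A, u ∈ closedNbhd G v) false A B from
    H _ ∅ ∅ le_rfl (by simp)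
  have full : ∀ A B : Finset V, (∀ v, v ∈ A ∨ v ∈ B) → (∀ u ∈ B, m u ≠ u → m u ∈ A) →
      ∀ v, v ∉ D → ∃ u ∈ A, u ∈ closedNbhd G v := by
    intro A B hAB hm v hv
    obtain ⟨u, hu, hmu, hne⟩ := hcov v hv
    rcases hAB u with h | h
    · exact ⟨u, h, hu⟩
    · exact ⟨m u, hm u h hne, hmu⟩
  intro k
  induction k with
  | zero =>
    intro A B hk hm
    have hfull : ∀ v, v ∈ A ∨ v ∈ B := by
      intro v
      by_contra hv
      have : v ∈ (A ∪ B)ᶜ := by simpa using hv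
      simp [Finset.card_eq_zero.1 (Nat.le_zero.1 hk)] at this
    exact .achieved _ _ _ (full A B hfull hm)
  | succ k ih =>
    intro A B hk hm
    by_cases hfree : ∃ v, v ∉ A ∧ v ∉ B
    swap
    · push Not at hfree
      exact .achieved _ _ _ (full A B (fun v => or_iff_not_imp_left.2 (hfree v)) hm)
    refine .opponentMove A B hfree fun v hvA hvB => ?_
    have hcard : ∀ w, ((insert w A ∪ insert v B)ᶜ).card ≤ k := by
      intro w
      have : (insert w A ∪ insert v B)ᶜ ⊂ (A ∪ B)ᶜ := by
        refine Finset.ssubset_iff_of_subset ?_ |>.2 ⟨v, by simp [hvA, hvB], by simp⟩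
        intro u
        simp only [Finset.mem_compl, Finset.mem_union, Finset.mem_insert]
        tauto
      exact Nat.le_of_lt_succ ((Finset.card_lt_card this).trans_le hk)
    by_cases hmv : m v ≠ v ∧ m v ∉ A
    · have hmB : m v ∉ B := fun h => hvA (by
        have := hm (m v) h (by rw [hinv]; exact hmv.1.symm)
        rwa [hinv] at this)
      refine .myMove _ _ (m v) hmv.2 (by simp [hmv.1, hmB]) (ih _ _ (hcard _) ?_)
      intro u hu hne
      rcases Finset.mem_insert.1 hu with rfl | hu
      · exact Finset.mem_insert_self _ _
      · exact Finset.mem_insert_of_mem (hm u hu hne)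
    -- No reply is needed here, and an arbitrary extra vertex does Dominator no harm.
    · have hm' : ∀ u ∈ insert v B, m u ≠ u → m u ∈ A := by
        intro u hu hne
        rcases Finset.mem_insert.1 hu with rfl | hu
        · by_contra h
          exact hmv ⟨hne, h⟩
        · exact hm u hu hne
      by_cases hw : ∃ w, w ∉ A ∧ w ∉ insert v B
      · obtain ⟨w, hwA, hwB⟩ := hw
        exact .myMove _ _ w hwA hwB
          (ih _ _ (hcard _) fun u hu hne => Finset.mem_insert_of_mem (hm' u hu hne))
      · push Not at hw
        exact .achieved _ _ _ (full A _ (fun v => or_iff_not_imp_left.2 (hw v)) hm')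

/-- A matching, given by an injection `f` from `S` to the complement of `S`, that covers
all vertices outside `D` yields a pairing strategy. -/
theorem dominatorWins_of_matching [Fintype V] {G : SimpleGraph V} {D : Finset V}
    (S : Set V) (f : V → V)
    (hadj : ∀ a ∈ S, G.Adj a (f a)) (hinj : Set.InjOn f S) (hS : ∀ a ∈ S, f a ∉ S)
    (hcov : ∀ v, v ∉ D → v ∈ S ∨ ∃ a ∈ S, f a = v) : DominatorWins G D := by
  classical
  let m : V → V := fun v => if v ∈ S then f v else if h : ∃ a ∈ S, f a = v then h.choose else v
  have m1 : ∀ a ∈ S, m a = f a := fun a ha => if_pos ha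
  have m2 : ∀ a ∈ S, m (f a) = a := by
    intro a ha
    have h : ∃ b ∈ S, f b = f a := ⟨a, ha, rfl⟩
    have : m (f a) = h.choose := by simp only [m]; rw [if_neg (hS a ha), dif_pos h]
    rw [this]
    exact hinj h.choose_spec.1 ha h.choose_spec.2
  refine dominatorWins_of_pairing m ?_ ?_
  · intro v
    by_cases hv : v ∈ S
    · rw [m1 v hv, m2 v hv]
    · by_cases h : ∃ a ∈ S, f a = v
      · obtain ⟨a, ha, rfl⟩ := h
        rw [m2 a ha, m1 a ha]
      · have : m v = v := by simp only [m]; rw [if_neg hv, dif_neg h]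
        rw [this, this]
  · intro v hv
    rcases hcov v hv with h | ⟨a, ha, rfl⟩
    · refine ⟨v, mem_closedNbhd.2 (.inl rfl), ?_, ?_⟩
      · rw [m1 v h]; exact mem_closedNbhd.2 (.inr (hadj v h))
      · rw [m1 v h]; exact (hadj v h).ne'
    · refine ⟨f a, mem_closedNbhd.2 (.inl rfl), ?_, ?_⟩
      · rw [m2 a ha]; exact mem_closedNbhd.2 (.inr (hadj a ha).symm)
      · rw [m2 a ha]; exact (hadj a ha).ne

/-- `S` and `Y` are what remains free of the two classes; the neighbours of `S` outside `Y` already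
belong to Staller. Each forced exchange deletes one vertex from either set and keeps the inequality.
-/
theorem canForce_closedNbhd_of_card_lt {G : SimpleGraph V} [DecidableRel G.Adj] {D : Finset V}
    (S Y A B : Finset V) (hSD : Disjoint S D) (hSY : Disjoint S Y)
    (hSA : Disjoint S A) (hSB : Disjoint S B) (hYA : Disjoint Y A) (hYB : Disjoint Y B)
    (hN : ∀ x ∈ S, ∀ u, G.Adj x u → u ∈ Y ∨ u ∈ A)
    (hdeg : ∀ y ∈ Y, (S.filter fun x => G.Adj x y).card ≤ 2) (hcard : Y.card < S.card) :
    CanForce (fun A : Finset V => ∃ v, v ∉ D ∧ closedNbhd G v ⊆ (A : Set V)) true A B := by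
  induction hk : S.card generalizing S Y A B with
  | zero => omega
  | succ k ih =>
    have hsum := Finset.sum_card_bipartiteAbove_eq_sum_card_bipartiteBelow G.Adj (s := S) (t := Y)
    have hle : ∑ y ∈ Y, (Finset.bipartiteBelow G.Adj S y).card ≤ Y.card * 2 :=
      Finset.sum_le_card_nsmul _ _ _ hdeg
    -- Double counting: two neighbours in `Y` for every `x` would need at least 2|S| > 2|Y| edges.
    obtain ⟨x, hx, hlt⟩ : ∃ x ∈ S, (Finset.bipartiteAbove G.Adj Y x).card < 2 := by
      by_contra! h
      have := Finset.card_nsmul_le_sum _ _ _ h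
      simp only [smul_eq_mul] at this
      omega
    have hxA := Finset.disjoint_left.1 hSA hx
    have hxB := Finset.disjoint_left.1 hSB hx
    have hxD := Finset.disjoint_left.1 hSD hx
    have hxY := Finset.disjoint_left.1 hSY hx
    rcases Nat.lt_succ_iff_lt_or_eq.1 hlt with h0 | h1
    · have h0 : Finset.bipartiteAbove G.Adj Y x = ∅ := Finset.card_eq_zero.1 (by omega)
      refine .myMove A B x hxA hxB (.achieved _ _ _ ⟨x, hxD, fun u hu => ?_⟩)
      rcases mem_closedNbhd.1 hu with rfl | hu
      · simp
      · rcases hN x hx u hu with h | h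
        · have : u ∈ Finset.bipartiteAbove G.Adj Y x := by simp [Finset.mem_bipartiteAbove, h, hu]
          simp [h0] at this
        · simp [h]
    · obtain ⟨y, hy⟩ := Finset.card_eq_one.1 h1
      have hyY : y ∈ Y ∧ G.Adj x y := by
        have : y ∈ Finset.bipartiteAbove G.Adj Y x := by simp [hy]
        simpa [Finset.mem_bipartiteAbove] using this
      have honly : ∀ u, G.Adj x u → u = y ∨ u ∈ A := by
        intro u hu
        rcases hN x hx u hu with h | h
        · left
          have : u ∈ Finset.bipartiteAbove G.Adj Y x := by simp [Finset.mem_bipartiteAbove, h, hu]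
          simpa [hy] using this
        · exact .inr h
      have hxy : x ≠ y := hyY.2.ne
      -- Claiming `y` leaves `x` as the only vertex of its closed neighbourhood that Staller lacks;
      -- any reply other than `x` loses at once.
      refine .myMove A B y (Finset.disjoint_left.1 hYA hyY.1) (Finset.disjoint_left.1 hYB hyY.1)
        (.opponentMove _ _ ⟨x, by simp [hxy, hxA], hxB⟩ fun v hvA hvB => ?_)
      by_cases hvx : v = x
      · subst hvx
        refine ih (S.erase v) (Y.erase y) _ _ ?_ ?_ ?_ ?_ ?_ ?_ ?_ ?_ ?_ ?_
        · exact hSD.mono_left (Finset.erase_subset _ _)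
        · exact hSY.mono (Finset.erase_subset _ _) (Finset.erase_subset _ _)
        · rw [Finset.disjoint_insert_right]
          refine ⟨fun h => ?_, hSA.mono_left (Finset.erase_subset _ _)⟩
          exact Finset.disjoint_left.1 hSY (Finset.mem_of_mem_erase h) hyY.1
        · rw [Finset.disjoint_insert_right]
          exact ⟨Finset.notMem_erase _ _, hSB.mono_left (Finset.erase_subset _ _)⟩
        · rw [Finset.disjoint_insert_right]
          exact ⟨Finset.notMem_erase _ _, hYA.mono_left (Finset.erase_subset _ _)⟩
        · rw [Finset.disjoint_insert_right]
          exact ⟨fun h => hxY (Finset.mem_of_mem_erase h),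
            hYB.mono_left (Finset.erase_subset _ _)⟩
        · intro w hw u hu
          rcases hN w (Finset.mem_of_mem_erase hw) u hu with h | h
          · by_cases huy : u = y
            · exact .inr (by simp [huy])
            · exact .inl (Finset.mem_erase.2 ⟨huy, h⟩)
          · exact .inr (Finset.mem_insert_of_mem h)
        · intro w hw
          exact (Finset.card_le_card (Finset.filter_subset_filter _ (Finset.erase_subset _ _))).trans
            (hdeg w (Finset.mem_of_mem_erase hw))
        · rw [Finset.card_erase_of_mem hx, Finset.card_erase_of_mem hyY.1]
          have := Finset.card_pos.2 ⟨y, hyY.1⟩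
          omega
        · rw [Finset.card_erase_of_mem hx]; omega
      · refine .myMove _ _ x (by simp [hxy, hxA]) (by simp [hxB, Ne.symm hvx])
          (.achieved _ _ _ ⟨x, hxD, fun u hu => ?_⟩)
        rcases mem_closedNbhd.1 hu with rfl | hu
        · simp
        · rcases honly u hu with rfl | h
          · simp
          · simp [h]

theorem stallerWins_of_card_lt {G : SimpleGraph V} [DecidableRel G.Adj] {D : Finset V}
    (S Y : Finset V) (hSD : Disjoint S D) (hSY : Disjoint S Y)
    (hN : ∀ x ∈ S, ∀ u, G.Adj x u → u ∈ Y)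
    (hdeg : ∀ y ∈ Y, (S.filter fun x => G.Adj x y).card ≤ 2) (hcard : Y.card < S.card) :
    StallerWins G D :=
  canForce_closedNbhd_of_card_lt S Y ∅ ∅ hSD hSY (by simp) (by simp) (by simp) (by simp)
    (fun x hx u hu => .inl (hN x hx u hu)) hdeg hcard

end Games

/-! ### Counting edges across a bipartition of a forest -/

section Forests

variable {V : Type*} [DecidableEq V]

/-- The number of edges between two disjoint sets of vertices of a forest; equality forces
the union to induce a tree all of whose edges join the two sets. -/
theorem card_edges_between_of_isAcyclic [Fintype V] {T : SimpleGraph V} [DecidableRel T.Adj]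
    (hT : T.IsAcyclic) {S Y : Finset V} (hd : Disjoint S Y) {W : Set V}
    (hW : W = ↑(S ∪ Y)) (hne : W.Nonempty) :
    (∑ y ∈ Y, (S.filter fun x => T.Adj x y).card) + 1 ≤ S.card + Y.card ∧
      (S.card + Y.card ≤ (∑ y ∈ Y, (S.filter fun x => T.Adj x y).card) + 1 →
        (T.induce W).Connected ∧
          ∀ u ∈ W, ∀ v ∈ W, T.Adj u v → u ∈ S ∧ v ∈ Y ∨ u ∈ Y ∧ v ∈ S) := by
  classical
  have : Nonempty W := hne.to_subtype
  -- The induced forest lies in a tree `F` on the same vertices, which has |W| - 1 edges. Equality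
  -- in the count therefore makes it equal to `F` and leaves no edge inside either set.
  obtain ⟨F, hHF, -, hF⟩ := (SimpleGraph.connected_top (V := W)).exists_isTree_le_of_le_of_isAcyclic
    (le_top (a := T.induce W)) (hT.induce W)
  have hcardW : Fintype.card W = S.card + Y.card := by
    rw [← Finset.card_union_of_disjoint hd, ← Set.toFinset_card]
    congr 1
    ext; simp [hW]
  have hFcard := hF.card_edgeFinset
  have hle : (T.induce W).edgeFinset.card ≤ F.edgeFinset.card :=
    Finset.card_le_card (SimpleGraph.edgeFinset_mono hHF)
  set P := (S ×ˢ Y).filter fun p => T.Adj p.1 p.2 with hP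
  have hPcard : P.card = ∑ y ∈ Y, (S.filter fun x => T.Adj x y).card := by
    rw [hP, Finset.card_filter, Finset.sum_product_right]
    exact Finset.sum_congr rfl fun y _ => (Finset.card_filter _ _).symm
  have hPinj : Set.InjOn (fun p : V × V => s(p.1, p.2)) P := by
    rintro ⟨a, b⟩ hab ⟨a', b'⟩ hab' h
    simp only [hP, Finset.coe_filter, Finset.mem_product, Set.mem_ofPred_eq] at hab hab'
    rcases Sym2.eq_iff.1 h with ⟨rfl, rfl⟩ | ⟨rfl, rfl⟩
    · rfl
    · exact absurd hab'.1.2 (Finset.disjoint_left.1 hd hab.1.1)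
  set E := (T.induce W).edgeFinset.image (Sym2.map Subtype.val) with hE
  have hEcard : E.card = (T.induce W).edgeFinset.card :=
    Finset.card_image_of_injective _ (Sym2.map.injective Subtype.val_injective)
  have hmemE : ∀ u ∈ W, ∀ v ∈ W, T.Adj u v → s(u, v) ∈ E := by
    intro u hu v hv huv
    exact Finset.mem_image.2 ⟨s(⟨u, hu⟩, ⟨v, hv⟩), by simpa using huv, by simp⟩
  have hsub : P.image (fun p => s(p.1, p.2)) ⊆ E := by
    intro e he
    obtain ⟨⟨a, b⟩, hab, rfl⟩ := Finset.mem_image.1 he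
    simp only [hP, Finset.mem_filter, Finset.mem_product] at hab
    exact hmemE a (by simp [hW, hab.1.1]) b (by simp [hW, hab.1.2]) hab.2
  have hPE : P.card ≤ E.card := by
    rw [← Finset.card_image_of_injOn hPinj]
    exact Finset.card_le_card hsub
  rw [← hPcard]
  refine ⟨by omega, fun hge => ⟨?_, ?_⟩⟩
  · have : (T.induce W).edgeFinset = F.edgeFinset :=
      Finset.eq_of_subset_of_card_le (SimpleGraph.edgeFinset_mono hHF) (by omega)
    rw [SimpleGraph.edgeFinset_inj.1 this]
    exact hF.connected
  · intro u hu v hv huv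
    have : P.image (fun p => s(p.1, p.2)) = E :=
      Finset.eq_of_subset_of_card_le hsub (by rw [Finset.card_image_of_injOn hPinj]; omega)
    have h := hmemE u hu v hv huv
    rw [← this] at h
    obtain ⟨⟨a, b⟩, hab, h⟩ := Finset.mem_image.1 h
    simp only [hP, Finset.mem_filter, Finset.mem_product] at hab
    rcases Sym2.eq_iff.1 h with ⟨rfl, rfl⟩ | ⟨rfl, rfl⟩
    · exact .inl hab.1
    · exact .inr hab.1.symm

end Forests

/-! ### The numerical test, and why the structure implies criticality -/

section CountTest

variable {V : Type*} [Fintype V] [DecidableEq V]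

/-- The number of neighbours of `y` outside `D`. -/
def outDegree (T : SimpleGraph V) [DecidableRel T.Adj] (D : Finset V) (y : V) : ℕ :=
  (Dᶜ.filter fun x => T.Adj x y).card

/-- A purely numerical form of the structural test. -/
structure CountTest (T : SimpleGraph V) [DecidableRel T.Adj] (D : Finset V) : Prop where
  indep : ∀ x y, x ∉ D → y ∉ D → ¬ T.Adj x y
  outDegree_eq : ∀ y ∈ D, outDegree T D y = 0 ∨ outDegree T D y = 2
  card_eq : Dᶜ.card = (D.filter fun y => outDegree T D y = 2).card + 1

variable {T : SimpleGraph V} [DecidableRel T.Adj] {D : Finset V}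

theorem outDegree_ne_zero_iff {y : V} : outDegree T D y ≠ 0 ↔ ∃ x, x ∉ D ∧ T.Adj x y := by
  rw [outDegree, Ne, Finset.card_eq_zero, ← Ne, ← Finset.nonempty_iff_ne_empty]
  simp [Finset.Nonempty]

theorem mem_testVerts_of_mem {y : V} (hy : y ∈ D) :
    y ∈ testVerts T D ↔ outDegree T D y ≠ 0 := by
  rw [outDegree_ne_zero_iff]
  constructor
  · rintro ⟨x, hx, h⟩
    rcases mem_closedNbhd.1 h with rfl | h
    · exact absurd hy hx
    · exact ⟨x, hx, h⟩
  · rintro ⟨x, hx, h⟩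
    exact ⟨x, hx, mem_closedNbhd.2 (.inr h)⟩

theorem mem_testVerts_of_notMem {V : Type*} {T : SimpleGraph V} {D : Finset V} {x : V}
    (hx : x ∉ D) : x ∈ testVerts T D :=
  ⟨x, hx, mem_closedNbhd.2 (.inl rfl)⟩

theorem ncard_neighborSet_eq_outDegree (y : testVerts T D)
    (h : ∀ x : testVerts T D, T.Adj y x → (x : V) ∉ D) :
    ((T.induce (testVerts T D)).neighborSet y).ncard = outDegree T D y := by
  rw [← Set.ncard_image_of_injective _ Subtype.val_injective, outDegree, ← Set.ncard_coe_finset]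
  congr 1
  ext x
  simp only [Set.mem_image, SimpleGraph.mem_neighborSet, SimpleGraph.comap_adj,
    Function.Embedding.subtype_apply, Finset.coe_filter, Finset.mem_compl, Set.mem_ofPred_eq]
  constructor
  · rintro ⟨x, hyx, rfl⟩
    exact ⟨h x hyx, hyx.symm⟩
  · rintro ⟨hx, hxy⟩
    exact ⟨⟨x, mem_testVerts_of_notMem hx⟩, hxy.symm, rfl⟩

theorem testVerts_eq (h : ∀ y ∈ D, outDegree T D y = 0 ∨ outDegree T D y = 2) :
    testVerts T D = ↑(Dᶜ ∪ D.filter fun y => outDegree T D y = 2) := by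
  ext u
  by_cases hu : u ∈ D
  · have := h u hu
    simp only [mem_testVerts_of_mem hu, Finset.coe_union, Set.mem_union, Finset.mem_coe,
      Finset.mem_compl, Finset.mem_filter, hu, not_true, true_and, false_or]
    omega
  · simp [hu, mem_testVerts_of_notMem hu]

theorem disjoint_compl_filter (p : V → Prop) [DecidablePred p] : Disjoint Dᶜ (D.filter p) :=
  disjoint_compl_left.mono_right (Finset.filter_subset _ _)

theorem sum_outDegree :
    ∑ y ∈ D.filter (fun y => outDegree T D y = 2), (Dᶜ.filter fun x => T.Adj x y).card =
      (D.filter fun y => outDegree T D y = 2).card * 2 := by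
  rw [Finset.sum_const_nat]
  intro y hy
  exact (Finset.mem_filter.1 hy).2

theorem CountTest.passesTest (hT : T.IsAcyclic) (h : CountTest T D) : PassesTest T D := by
  have hW := testVerts_eq h.outDegree_eq
  have hne : (testVerts T D).Nonempty := by
    obtain ⟨x, hx⟩ := Finset.card_pos.1 (by rw [h.card_eq]; omega : 0 < Dᶜ.card)
    exact ⟨x, mem_testVerts_of_notMem (by simpa using hx)⟩
  -- With |X| = |Y| + 1, the 2|Y| edges between X and Y attain the maximum |X| + |Y| - 1.
  obtain ⟨hconn, hbip⟩ := (card_edges_between_of_isAcyclic hT (disjoint_compl_filter _) hW hne).2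
    (by rw [sum_outDegree]; have := h.card_eq; omega)
  refine ⟨hconn, {w | (w : V) ∉ D}, {w | (w : V) ∈ D}, ⟨?_, ?_, ?_⟩, ?_, ?_⟩
  · ext w; simp [em']
  · exact Set.disjoint_left.2 fun w h h' => h h'
  · intro u v huv
    have := hbip u u.2 v v.2 huv
    simp only [Finset.mem_compl, Finset.mem_filter] at this
    simp only [Set.mem_ofPred_eq]
    tauto
  · ext x
    simp only [Set.mem_image, Set.mem_ofPred_eq]
    exact ⟨fun ⟨w, hw, e⟩ => e ▸ hw, fun hx => ⟨⟨x, mem_testVerts_of_notMem hx⟩, hx, rfl⟩⟩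
  · intro y hy
    have hy : (y : V) ∈ D := hy
    rw [ncard_neighborSet_eq_outDegree]
    · exact (h.outDegree_eq y hy).resolve_left ((mem_testVerts_of_mem hy).1 y.2)
    · intro x hyx
      have := hbip y y.2 x x.2 hyx
      simp only [Finset.mem_compl, Finset.mem_filter] at this
      tauto

theorem PassesTest.adj {V : Type*} {T : SimpleGraph V} {D : Finset V} (h : PassesTest T D)
    {u v : testVerts T D} (huv : T.Adj u v) :
    (u : V) ∉ D ∧ (v : V) ∈ D ∨ (u : V) ∈ D ∧ (v : V) ∉ D := by
  obtain ⟨-, V₀, V₁, ⟨-, hb⟩, hX, -⟩ := h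
  have h₀ : ∀ w ∈ V₀, (w : V) ∉ D := by
    intro w hw
    have : (w : V) ∈ Subtype.val '' V₀ := ⟨w, hw, rfl⟩
    rw [hX] at this
    exact this
  have h₁ : ∀ w ∈ V₁, (w : V) ∈ D := by
    intro w hw
    by_contra hwD
    obtain ⟨w', hw', e⟩ : (w : V) ∈ Subtype.val '' V₀ := hX ▸ hwD
    rw [Subtype.ext e] at hw'
    exact Set.disjoint_left.1 hb.disjoint hw' hw
  have huv' : (T.induce (testVerts T D)).Adj u v := huv
  exact (hb.mem_of_adj huv').imp (fun h => ⟨h₀ u h.1, h₁ v h.2⟩) (fun h => ⟨h₁ u h.1, h₀ v h.2⟩)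

theorem PassesTest.indep {V : Type*} {T : SimpleGraph V} {D : Finset V} (h : PassesTest T D)
    {x y : V} (hx : x ∉ D) (hy : y ∉ D) : ¬ T.Adj x y := by
  intro hxy
  have := h.adj (u := ⟨x, mem_testVerts_of_notMem hx⟩) (v := ⟨y, mem_testVerts_of_notMem hy⟩) hxy
  tauto

theorem PassesTest.outDegree_eq (h : PassesTest T D) {y : V} (hy : y ∈ D) :
    outDegree T D y = 0 ∨ outDegree T D y = 2 := by
  by_cases h0 : outDegree T D y = 0
  · exact .inl h0
  right
  let w : testVerts T D := ⟨y, (mem_testVerts_of_mem hy).2 h0⟩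
  rw [← ncard_neighborSet_eq_outDegree w]
  · obtain ⟨-, V₀, V₁, ⟨hu, -⟩, hX, hdeg⟩ := h
    refine hdeg w ((hu ▸ Set.mem_univ w : w ∈ V₀ ∪ V₁).resolve_left fun hw => ?_)
    have : (w : V) ∈ Subtype.val '' V₀ := ⟨w, hw, rfl⟩
    rw [hX] at this
    exact this hy
  · intro x hx
    have := h.adj (u := w) hx
    tauto

/-- The forest bound 2|Y| + 1 ≤ |X| + |Y| gives |Y| < |X|, as Staller's forcing sequence requires.
-/
theorem PassesTest.stallerWins (hT : T.IsAcyclic) (h : PassesTest T D) : StallerWins T D := by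
  have hW := testVerts_eq fun y hy => h.outDegree_eq hy
  have hne : (testVerts T D).Nonempty := Set.nonempty_coe_sort.1 h.1.nonempty
  have hc := (card_edges_between_of_isAcyclic hT (disjoint_compl_filter _) hW hne).1
  rw [sum_outDegree] at hc
  refine stallerWins_of_card_lt Dᶜ (D.filter fun y => outDegree T D y = 2) disjoint_compl_left
    (disjoint_compl_filter _) ?_ ?_ (by omega)
  · intro x hx u hxu
    have hx : x ∉ D := by simpa using hx
    have hu : u ∈ D := by
      by_contra hu
      exact h.indep hx hu hxu
    exact Finset.mem_filter.2 ⟨hu, (h.outDegree_eq hu).resolve_left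
      (outDegree_ne_zero_iff.2 ⟨x, hx, hxu⟩)⟩
  · intro y hy
    exact (Finset.mem_filter.1 hy).2.le

/-- Each vertex outside `insert v D` is matched to a neighbour `p x` closer to `v` in T'. -/
theorem PassesTest.dominatorWins (h : PassesTest T D) {v : V} (hv : v ∉ D) :
    DominatorWins T (insert v D) := by
  classical
  let H := T.induce (testVerts T D)
  let r : testVerts T D := ⟨v, mem_testVerts_of_notMem hv⟩
  have hstep : ∀ w : testVerts T D, w ≠ r → ∃ z, H.Adj w z ∧ H.dist z r < H.dist w r := by
    intro w hw
    obtain ⟨p, hp⟩ := h.1.exists_walk_length_eq_dist w r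
    cases p with
    | nil => exact absurd rfl hw
    | cons hadj q =>
      refine ⟨_, hadj, ?_⟩
      have := SimpleGraph.dist_le q
      rw [SimpleGraph.Walk.length_cons] at hp
      change _ = H.dist w r at hp
      change H.dist _ r ≤ _ at this
      omega
  choose! p hadj hdist using hstep
  let f : V → V := fun x => if hx : x ∈ testVerts T D then p ⟨x, hx⟩ else x
  have hf : ∀ w : testVerts T D, f w = p w := fun w => dif_pos w.2
  have hpD : ∀ w : testVerts T D, (w : V) ∉ D → w ≠ r → (p w : V) ∈ D := by
    intro w hw hwr
    by_contra hp
    exact h.indep hw hp (hadj w hwr)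
  have hS : ∀ x, x ∉ insert v D → ∃ w : testVerts T D, (w : V) = x ∧ x ∉ D ∧ w ≠ r := by
    intro x hx
    rw [Finset.mem_insert, not_or] at hx
    exact ⟨⟨x, mem_testVerts_of_notMem hx.2⟩, rfl, hx.2, fun e => hx.1 (congrArg Subtype.val e)⟩
  refine dominatorWins_of_matching {x | x ∉ insert v D} f ?_ ?_ ?_ fun x hx => .inl hx
  · intro x hx
    obtain ⟨w, rfl, hwD, hwr⟩ := hS x hx
    rw [hf]
    exact hadj w hwr
  · intro x hx x' hx' hxx'
    obtain ⟨w, rfl, hwD, hwr⟩ := hS x hx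
    obtain ⟨w', rfl, hwD', hwr'⟩ := hS x' hx'
    rw [hf, hf] at hxx'
    have hpp : p w = p w' := Subtype.ext hxx'
    have hy := hpD w hwD hwr
    have hyr : p w ≠ r := fun e => hv (by rw [e] at hy; exact hy)
    by_contra hne
    have hd1 := hdist w hwr
    have hd2 := hdist w' hwr'
    have hd3 := hdist (p w) hyr
    rw [← hpp] at hd2
    -- If `w` and `w'` shared the vertex `p w`, its next vertex towards `v` would be a third
    -- neighbour outside `D`, distinct from both because it is nearer to `v`.
    have hsub : ({(w : V), (w' : V), (p (p w) : V)} : Finset V) ⊆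
        Dᶜ.filter fun x => T.Adj x (p w) := by
      have hzD : (p (p w) : V) ∉ D := by
        have := h.adj (hadj (p w) hyr)
        tauto
      intro u hu
      simp only [Finset.mem_insert, Finset.mem_singleton] at hu
      simp only [Finset.mem_filter, Finset.mem_compl]
      rcases hu with rfl | rfl | rfl
      · exact ⟨hwD, hadj w hwr⟩
      · exact ⟨hwD', by rw [hpp]; exact hadj w' hwr'⟩
      · exact ⟨hzD, (hadj (p w) hyr).symm⟩
    have hcard := Finset.card_le_card hsub
    have h3 : ({(w : V), (w' : V), (p (p w) : V)} : Finset V).card = 3 := by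
      refine Finset.card_eq_three.2 ⟨_, _, _, hne, ?_, ?_, rfl⟩
      · intro e
        rw [← Subtype.ext e] at hd3
        omega
      · intro e
        rw [← Subtype.ext e] at hd3
        omega
    have := h.outDegree_eq hy
    rw [h3] at hcard
    unfold outDegree at this
    omega
  · intro x hx
    obtain ⟨w, rfl, hwD, hwr⟩ := hS x hx
    rw [hf]
    simp [hpD w hwD hwr]

theorem PassesTest.critical (hT : T.IsAcyclic) (h : PassesTest T D) : Critical T D :=
  ⟨h.stallerWins hT, fun _ hv => h.dominatorWins hv⟩

end CountTest

/-! ### From a win of Staller to the structure, by Hall's theorem -/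

section Matchings

variable {V : Type*}

/-- Let `f` be injective on the complement of `D` and change a `2`-colouring `c`. The vertices of
colour `0` on the orbits of `f ∘ f` that begin at a vertex outside the range. -/
inductive Alternating (D : Finset V) (c : V → Fin 2) (f : V → V) : V → Prop
  | start (a : V) : a ∉ D → c a = 0 → (∀ b, b ∉ D → f b ≠ a) → Alternating D c f a
  | step (a : V) : Alternating D c f a → f a ∉ D → f (f a) ∉ D → Alternating D c f (f (f a))

/-- The arrows x → f x with x outside `D` form paths, ending in `D`, and cycles, even because `f`
changes the colour. Every second arrow is kept: on a path starting from its first vertex, on a cycle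
those leaving colour 1. The kept arrows form a matching covering the complement of `D`. -/
theorem dominatorWins_of_injOn [Fintype V] [DecidableEq V] {G : SimpleGraph V} {D : Finset V}
    (c : G.Coloring (Fin 2)) (f : V → V) (hadj : ∀ x, x ∉ D → G.Adj x (f x))
    (hinj : ∀ x y, x ∉ D → y ∉ D → f x = f y → x = y) : DominatorWins G D := by
  have hc : ∀ x, x ∉ D → c (f x) ≠ c x := fun x hx => (c.valid (hadj x hx)).symm
  have hA : ∀ a, Alternating D c f a → a ∉ D ∧ c a = 0 := by
    intro a ha
    induction ha with
    | start a ha h0 _ => exact ⟨ha, h0⟩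
    | step a _ hfa hffa ih =>
      refine ⟨hffa, ?_⟩
      have h1 := hc a ih.1
      have h2 := hc _ hfa
      omega
  have hA' : ∀ a b, Alternating D c f a → a = f b → b ∉ D →
      ∃ a', Alternating D c f a' ∧ f a' = b := by
    intro a b ha hab hb
    cases ha with
    | start a _ _ h => exact absurd hab.symm (h b hb)
    | step a ha hfa _ => exact ⟨a, ha, hinj _ _ hfa hb hab⟩
  -- Tails of the kept arrows: colour 0 on paths that begin with colour 0, colour 1 everywhere else.
  let S : Set V := {a | Alternating D c f a ∨
    a ∉ D ∧ c a = 1 ∧ ∀ a', Alternating D c f a' → f a' ≠ a}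
  have hS : ∀ a ∈ S, a ∉ D := fun a ha => ha.elim (fun h => (hA a h).1) And.left
  refine dominatorWins_of_matching S f (fun a ha => hadj a (hS a ha))
    (fun a ha b hb => hinj a b (hS a ha) (hS b hb)) ?_ ?_
  · rintro a (ha | ⟨haD, ha1, ha⟩) (hf | ⟨hfD, hf1, hf⟩)
    · have h1 := hc a (hA a ha).1
      have h2 := (hA a ha).2
      have h3 := (hA _ hf).2
      omega
    · exact hf a ha rfl
    · obtain ⟨a', ha', e⟩ := hA' _ a hf rfl haD
      exact ha a' ha' e
    · have := hc a haD
      omega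
  · intro v hv
    by_cases hv1 : c v = 1
    · by_cases h : ∃ a, Alternating D c f a ∧ f a = v
      · obtain ⟨a, ha, e⟩ := h
        exact .inr ⟨a, .inl ha, e⟩
      · push Not at h
        exact .inl (.inr ⟨hv, hv1, h⟩)
    · have hv0 : c v = 0 := by omega
      by_cases hvA : Alternating D c f v
      · exact .inl (.inl hvA)
      · right
        obtain ⟨b, hb, e⟩ : ∃ b, b ∉ D ∧ f b = v := by
          by_contra! h
          exact hvA (.start v hv hv0 h)
        refine ⟨b, .inr ⟨hb, ?_, ?_⟩, e⟩
        · have := hc b hb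
          rw [e] at this
          omega
        · intro a ha hab
          apply hvA
          have := Alternating.step a ha (by rwa [hab]) (by rwa [hab, e])
          rwa [hab, e] at this

variable [Fintype V] [DecidableEq V] {T : SimpleGraph V} [DecidableRel T.Adj]

theorem exists_injOn_or_exists_card_lt (T : SimpleGraph V) [DecidableRel T.Adj] (X : Finset V) :
    (∃ f : V → V, (∀ x ∈ X, T.Adj x (f x)) ∧ Set.InjOn f X) ∨
      ∃ S ⊆ X, (S.biUnion (T.neighborFinset ·)).card < S.card := by
  by_cases h : ∀ s : Finset X, s.card ≤ (s.biUnion fun x => T.neighborFinset x).card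
  · left
    obtain ⟨f, hf, hmem⟩ := (Finset.all_card_le_biUnion_card_iff_exists_injective _).1 h
    refine ⟨fun v => if hv : v ∈ X then f ⟨v, hv⟩ else v, ?_, ?_⟩
    · intro x hx
      simpa [hx] using hmem ⟨x, hx⟩
    · intro x hx y hy hxy
      have hx : x ∈ X := hx
      have hy : y ∈ X := hy
      simp only [hx, hy, dif_pos] at hxy
      exact congrArg Subtype.val (hf hxy)
  · right
    push Not at h
    obtain ⟨s, hs⟩ := h
    refine ⟨s.map (Function.Embedding.subtype _), fun x hx => ?_, ?_⟩
    · obtain ⟨y, -, rfl⟩ := Finset.mem_map.1 hx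
      exact y.2
    · rwa [Finset.map_eq_image, Finset.image_biUnion, Finset.card_image_of_injective _
        (Function.Embedding.injective _)]

/-- In a forest, a minimal violator of Hall's condition among the subsets of an independent set
is numerically the set of branch vertices of a subdivided tree. -/
theorem exists_countTest_of_card_lt (hT : T.IsAcyclic) {X : Finset V}
    (hX : ∀ x ∈ X, ∀ y ∈ X, ¬ T.Adj x y) (h : (X.biUnion (T.neighborFinset ·)).card < X.card) :
    ∃ S ⊆ X, CountTest T Sᶜ := by
  obtain ⟨S, hS, hmin⟩ := Finset.exists_min_image
    (X.powerset.filter fun S => (S.biUnion (T.neighborFinset ·)).card < S.card) Finset.card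
    ⟨X, by simpa using h⟩
  simp only [Finset.mem_filter, Finset.mem_powerset] at hS hmin
  obtain ⟨hSX, hlt⟩ := hS
  set N := S.biUnion (T.neighborFinset ·) with hN
  have hmemN : ∀ y, y ∈ N ↔ ∃ x ∈ S, T.Adj x y := by simp [hN]
  have hind : ∀ x ∈ S, ∀ y ∈ S, ¬ T.Adj x y := fun x hx y hy => hX x (hSX hx) y (hSX hy)
  have hd : Disjoint S N := Finset.disjoint_left.2 fun x hx hxN => by
    obtain ⟨y, hy, hyx⟩ := (hmemN x).1 hxN
    exact hind y hy x hx hyx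
  have herase : ∀ x ∈ S, S.card ≤ ((S.erase x).biUnion (T.neighborFinset ·)).card + 1 := by
    intro x hx
    by_contra! hlt'
    have h1 := Finset.card_erase_of_mem hx
    have h2 := Finset.card_pos.2 ⟨x, hx⟩
    have := hmin (S.erase x) ⟨(Finset.erase_subset _ _).trans hSX, by omega⟩
    omega
  have hsub : ∀ x, (S.erase x).biUnion (T.neighborFinset ·) ⊆ N := fun x =>
    Finset.biUnion_subset_biUnion_of_subset_left _ (Finset.erase_subset _ _)
  -- By minimality, `S` minus one vertex satisfies Hall's inequality, so the deficiency of `S` is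
  -- exactly one.
  obtain ⟨x₀, hx₀⟩ := Finset.card_pos.1 (by omega : 0 < S.card)
  have hcard : S.card = N.card + 1 := by
    have := herase x₀ hx₀
    have := Finset.card_le_card (hsub x₀)
    omega
  -- If `y` had only one neighbour `x` in `S`, deleting `x` would also remove `y` from the
  -- neighbourhood and leave a smaller violator.
  have hdeg : ∀ y ∈ N, 2 ≤ (S.filter fun x => T.Adj x y).card := by
    intro y hy
    obtain ⟨x, hx, hxy⟩ := (hmemN y).1 hy
    by_contra! hlt2
    have hyx : y ∉ (S.erase x).biUnion (T.neighborFinset ·) := by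
      intro hyx
      obtain ⟨x', hx', hx'y⟩ := Finset.mem_biUnion.1 hyx
      rw [Finset.mem_erase] at hx'
      have : ({x, x'} : Finset V) ⊆ S.filter fun x => T.Adj x y := by
        intro u hu
        simp only [Finset.mem_insert, Finset.mem_singleton] at hu
        rcases hu with rfl | rfl
        · simp [hx, hxy]
        · simpa [hx'.2] using hx'y
      have := Finset.card_le_card this
      rw [Finset.card_pair hx'.1.symm] at this
      omega
    have h1 := herase x hx
    have h2 := Finset.card_lt_card ((Finset.ssubset_iff_of_subset (hsub x)).2 ⟨y, hy, hyx⟩)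
    omega
  have hcount := (card_edges_between_of_isAcyclic hT hd rfl ⟨x₀, by simp [hx₀]⟩).1
  -- The forest bound |S| + |N| - 1 equals 2|N|, so no degree can exceed 2.
  have hdeg2 : ∀ y ∈ N, (S.filter fun x => T.Adj x y).card = 2 := by
    have hsum : ∑ y ∈ N, (S.filter fun x => T.Adj x y).card ≤ ∑ y ∈ N, 2 := by
      rw [Finset.sum_const, smul_eq_mul]; omega
    intro y hy
    exact ((Finset.sum_eq_sum_iff_of_le hdeg).1
      (le_antisymm (Finset.sum_le_sum hdeg) hsum) y hy).symm
  have hout : ∀ y, outDegree T Sᶜ y = (S.filter fun x => T.Adj x y).card := by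
    intro y; rw [outDegree, compl_compl]
  refine ⟨S, hSX, ⟨?_, ?_, ?_⟩⟩
  · intro x y hx hy
    exact hind x (by simpa using hx) y (by simpa using hy)
  · intro y _
    by_cases hy : y ∈ N
    · exact .inr ((hout y).trans (hdeg2 y hy))
    · left
      by_contra h0
      obtain ⟨x, hx, hxy⟩ := outDegree_ne_zero_iff.1 h0
      exact hy ((hmemN y).2 ⟨x, by simpa using hx, hxy⟩)
  · rw [compl_compl, hcard]
    congr 2
    ext y
    rw [Finset.mem_filter, Finset.mem_compl]
    constructor
    · exact fun hy => ⟨Finset.disjoint_right.1 hd hy, (hout y).trans (hdeg2 y hy)⟩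
    · rintro ⟨-, hy⟩
      obtain ⟨x, hx, hxy⟩ := outDegree_ne_zero_iff.1 (by rw [hy]; decide)
      exact (hmemN y).2 ⟨x, by simpa using hx, hxy⟩

/-- Hall's theorem is applied to each colour class separately: a violator is then independent, and
the two injections have images of different colours, so they combine to an injection. -/
theorem StallerWins.exists_countTest (hT : T.IsAcyclic) {D : Finset V} (h : StallerWins T D) :
    ∃ D', D ⊆ D' ∧ CountTest T D' := by
  let c := hT.coloringTwo
  have key : ∀ i, (∃ f : V → V, (∀ x, x ∉ D → c x = i → T.Adj x (f x)) ∧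
      ∀ x y, x ∉ D → y ∉ D → c x = i → c y = i → f x = f y → x = y) ∨
      ∃ D', D ⊆ D' ∧ CountTest T D' := by
    intro i
    rcases exists_injOn_or_exists_card_lt T (Dᶜ.filter fun x => c x = i) with
      ⟨f, hf, hinj⟩ | ⟨S, hS, hlt⟩
    · exact .inl ⟨f, fun x hx hi => hf x (by simp [hx, hi]),
        fun x y hx hy hxi hyi => hinj (by simp [hx, hxi]) (by simp [hy, hyi])⟩
    · right
      have hSmem : ∀ x ∈ S, x ∉ D ∧ c x = i := fun x hx => by simpa using hS hx
      obtain ⟨S', hS', hc⟩ := exists_countTest_of_card_lt hT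
        (fun x hx y hy hxy => c.valid hxy ((hSmem x hx).2.trans (hSmem y hy).2.symm)) hlt
      exact ⟨S'ᶜ, fun v hv => Finset.mem_compl.2 fun hvS => (hSmem v (hS' hvS)).1 hv, hc⟩
  rcases key 0 with ⟨f₀, hf₀, hi₀⟩ | h0
  swap
  · exact h0
  rcases key 1 with ⟨f₁, hf₁, hi₁⟩ | h1
  swap
  · exact h1
  refine absurd ?_ h.not_dominatorWins
  have hc1 : ∀ x, c x ≠ 0 → c x = 1 := fun x hx => by omega
  have hadj : ∀ x, x ∉ D → T.Adj x (if c x = 0 then f₀ x else f₁ x) := by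
    intro x hx
    split_ifs with hcx
    · exact hf₀ x hx hcx
    · exact hf₁ x hx (hc1 x hcx)
  refine dominatorWins_of_injOn c (fun x => if c x = 0 then f₀ x else f₁ x) hadj ?_
  intro x y hx hy hxy
  have hcol : c x = c y := by
    have h1 := c.valid (hadj x hx)
    have h2 := c.valid (hadj y hy)
    rw [hxy] at h1
    omega
  simp only [← hcol] at hxy
  split_ifs at hxy with hcx
  · exact hi₀ x y hx hy hcx (hcol ▸ hcx) hxy
  · exact hi₁ x y hx hy (hc1 x hcx) (hcol ▸ hc1 x hcx) hxy

/-- A vertex `v` of `D'` outside `D` could be added to `D` with Staller still winning, as she wins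
even on `D'`. -/
theorem Critical.countTest (hT : T.IsAcyclic) {D : Finset V} (h : Critical T D) :
    CountTest T D := by
  obtain ⟨D', hDD', hc⟩ := h.1.exists_countTest hT
  suffices D' ⊆ D by rwa [hDD'.antisymm this]
  intro v hv
  by_contra hvD
  have hs := (hc.passesTest hT).stallerWins hT
  exact (hs.anti (Finset.insert_subset hv hDD')).not_dominatorWins (h.2 v hvD)

theorem critical_iff_countTest (hT : T.IsAcyclic) {D : Finset V} :
    Critical T D ↔ CountTest T D :=
  ⟨fun h => h.countTest hT, fun h => (h.passesTest hT).critical hT⟩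

theorem critical_iff_passesTest {V : Type*} [Fintype V] [DecidableEq V] {T : SimpleGraph V}
    (hT : T.IsAcyclic) {D : Finset V} : Critical T D ↔ PassesTest T D := by
  classical
  exact ⟨fun h => (h.countTest hT).passesTest hT, fun h => h.critical hT⟩

end Matchings

/-! ### Rules for running time and final state of programs -/

section Hoare

/-- Started in the state `s`, the program halts within `C` units of time in a state with `R`. -/
def Halts (W : ℕ) (P : Prog) (s : State) (C : ℕ) (R : State → Prop) : Prop :=
  ∃ t s', Exec W P s t s' ∧ t ≤ C ∧ R s'

variable {W C C₁ C₂ : ℕ} {P Q : Prog} {s : State} {R R' : State → Prop} {a e : Expr} {r : ℕ}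

theorem Halts.mono (h : Halts W P s C₁ R) (hC : C₁ ≤ C) (hR : ∀ s, R s → R' s) :
    Halts W P s C R' := by
  obtain ⟨t, s', he, ht, hs⟩ := h
  exact ⟨t, s', he, ht.trans hC, hR s' hs⟩

theorem Halts.skip (h : R s) : Halts W .skip s 1 R := ⟨_, _, .skip s, le_rfl, h⟩

theorem Halts.assign (he : e.Fits W s) (h : R ⟨Function.update s.reg r (e.eval s), s.mem⟩) :
    Halts W (.assign r e) s (e.cost + 1) R := ⟨_, _, .assign s r e he, le_rfl, h⟩

theorem Halts.store (ha : a.Fits W s) (he : e.Fits W s)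
    (h : R ⟨s.reg, Function.update s.mem (a.eval s) (e.eval s)⟩) :
    Halts W (.store a e) s (a.cost + e.cost + 1) R := ⟨_, _, .store s a e ha he, le_rfl, h⟩

theorem Halts.seq (h : Halts W P s C₁ fun s' => Halts W Q s' C₂ R) :
    Halts W (.seq P Q) s (C₁ + C₂) R := by
  obtain ⟨t, s', he, ht, t', s'', he', ht', hs⟩ := h
  exact ⟨_, _, .seq P Q s s' s'' t t' he he', by omega, hs⟩

theorem Halts.cond (he : e.Fits W s) (h₁ : e.eval s ≠ 0 → Halts W P s C₁ R)
    (h₂ : e.eval s = 0 → Halts W Q s C₂ R) :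
    Halts W (.cond e P Q) s (e.cost + 1 + (C₁ + C₂)) R := by
  by_cases h : e.eval s = 0
  · obtain ⟨t, s', hx, ht, hs⟩ := h₂ h
    exact ⟨_, _, .condFalse e P Q s s' t he h hx, by omega, hs⟩
  · obtain ⟨t, s', hx, ht, hs⟩ := h₁ h
    exact ⟨_, _, .condTrue e P Q s s' t he h hx, by omega, hs⟩

/-- A loop that is controlled by a counter. -/
theorem Halts.loop {I : ℕ → State → Prop} (he : ∀ k s, I k s → e.Fits W s ∧ e.eval s = k)
    (h : ∀ k s, I (k + 1) s → Halts W P s C (I k)) :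
    ∀ k s, I k s → Halts W (.loop e P) s (k * (C + e.cost + 1) + (e.cost + 1)) (I 0) := by
  intro k
  induction k with
  | zero =>
    intro s hs
    obtain ⟨h1, h2⟩ := he 0 s hs
    exact ⟨_, _, .loopFalse e P s h1 h2, by omega, hs⟩
  | succ k ih =>
    intro s hs
    obtain ⟨h1, h2⟩ := he _ s hs
    obtain ⟨t, s', hx, ht, hs'⟩ := h k s hs
    obtain ⟨t', s'', hx', ht', hs''⟩ := ih s' hs'
    refine ⟨_, _, .loopTrue e P s s' s'' t t' h1 (by omega) hx hx', ?_, hs''⟩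
    rw [Nat.add_mul]
    omega

end Hoare

/-! ### The program, and one step of its edge loop -/

section Program

/-- Add one to the memory cell whose address is in register `r`. -/
def incr (r : ℕ) : Prog := .store (.reg r) (.add (.load (.reg r)) (.const 1))

/-- Process the edge at the address in register `2`: if exactly one end is outside `D`, add one to
the cell of the other end; if both are, set the flag in register `3`. -/
def edgeBody : Prog :=
  .seq (.assign 4 (.add (.load (.reg 2)) (.const 1)))
  (.seq (.assign 5 (.add (.load (.add (.reg 2) (.const 1))) (.const 1)))
  (.seq (.cond (.load (.reg 4)) (.cond (.load (.reg 5)) .skip (incr 4))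
      (.cond (.load (.reg 5)) (incr 5) (.assign 3 (.const 1))))
  (.seq (.assign 2 (.add (.reg 2) (.const 2))) (.assign 1 (.sub (.reg 1) (.const 1))))))

/-- Process the vertex whose cell has its address in register `1`: register `6` counts the
vertices outside `D`, register `7` those with exactly two neighbours outside `D`. -/
def vertexBody : Prog :=
  .seq (.assign 4 (.load (.reg 1)))
  (.seq (.cond (.reg 4)
      (.cond (.sub (.reg 4) (.const 1))
        -- The two truncated differences add up to |cell - 3|; content 3 means two neighbours
        -- outside `D`.
        (.cond (.add (.sub (.reg 4) (.const 3)) (.sub (.const 3) (.reg 4)))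
          (.assign 3 (.const 1))
          (.assign 7 (.add (.reg 7) (.const 1))))
        .skip)
      (.assign 6 (.add (.reg 6) (.const 1))))
  (.assign 1 (.sub (.reg 1) (.const 1))))

/-- The numerical test for criticality. -/
def criticalProg : Prog :=
  -- A tree has n - 1 edges, so n determines the length of the edge list, which starts at address n
  -- + 1.
  .seq (.assign 1 (.sub (.load (.const 0)) (.const 1)))
  (.seq (.assign 2 (.add (.load (.const 0)) (.const 1)))
  (.seq (.loop (.reg 1) edgeBody)
  (.seq (.assign 1 (.load (.const 0)))
  (.seq (.loop (.reg 1) vertexBody)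
  (.cond (.reg 3) .skip
    (.cond (.add (.sub (.reg 6) (.add (.reg 7) (.const 1)))
        (.sub (.add (.reg 7) (.const 1)) (.reg 6)))
      .skip (.assign 0 (.const 1))))))))

variable {n : ℕ}

/-- The number of edges in the list that join `v` to a vertex outside `D`. -/
def edgeCount (D : Finset (Fin n)) (es : List (Fin n × Fin n)) (v : Fin n) : ℕ :=
  es.countP fun p => (p.1 = v ∧ p.2 ∉ D) ∨ (p.2 = v ∧ p.1 ∉ D)

/-- The content of the cell of `v` after the edges in the list have been processed. -/
def cell (D : Finset (Fin n)) (es : List (Fin n × Fin n)) (v : Fin n) : ℕ :=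
  if v ∈ D then edgeCount D es v + 1 else 0

theorem cell_le (D : Finset (Fin n)) (es : List (Fin n × Fin n)) (v : Fin n) :
    cell D es v ≤ es.length + 1 := by
  unfold cell edgeCount
  split_ifs
  · exact Nat.add_le_add_right List.countP_le_length 1
  · omega

/-- The offset by one lets the indicator of `D` serve as the counter: the input value 1 means "in
`D`, count 0", and membership stays readable. -/
theorem cell_ne_zero {D : Finset (Fin n)} {es : List (Fin n × Fin n)} {v : Fin n} :
    cell D es v ≠ 0 ↔ v ∈ D := by
  unfold cell; split_ifs with h <;> simp [h]

theorem cell_eq_zero {D : Finset (Fin n)} {es : List (Fin n × Fin n)} {v : Fin n} :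
    cell D es v = 0 ↔ v ∉ D := by
  rw [← not_iff_not, not_not, ← cell_ne_zero]

theorem cell_append (D : Finset (Fin n)) (es : List (Fin n × Fin n)) (p : Fin n × Fin n)
    (v : Fin n) : cell D (es ++ [p]) v = cell D es v +
      if v ∈ D ∧ ((p.1 = v ∧ p.2 ∉ D) ∨ (p.2 = v ∧ p.1 ∉ D)) then 1 else 0 := by
  unfold cell edgeCount
  by_cases hv : v ∈ D
  · simp only [hv, List.countP_append, List.countP_singleton, if_true, true_and,
      decide_eq_true_eq]
    omega
  · simp [hv]

/-- The situation after the edges in the list `es` have been processed. -/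
structure EdgeInv (D : Finset (Fin n)) (w : List ℕ) (es : List (Fin n × Fin n)) (s : State) :
    Prop where
  reg_zero : s.reg 0 = 0
  reg_six : s.reg 6 = 0
  reg_seven : s.reg 7 = 0
  flag_le : s.reg 3 ≤ 1
  flag : s.reg 3 = 0 ↔ ∀ p ∈ es, p.1 ∈ D ∨ p.2 ∈ D
  mem_zero : s.mem 0 = n
  mem_cell : ∀ v : Fin n, s.mem (v + 1) = cell D es v
  mem_rest : ∀ j, n < j → s.mem j = w.getD j 0

theorem halts_edgeBody {W : ℕ} {D : Finset (Fin n)} {w : List ℕ} {es : List (Fin n × Fin n)}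
    {p : Fin n × Fin n} {k : ℕ} {s : State} (hs : EdgeInv D w es s) (hr1 : s.reg 1 = k + 1)
    (hr2 : s.reg 2 = n + 1 + 2 * es.length)
    (h1 : w.getD (n + 1 + 2 * es.length) 0 = p.1)
    (h2 : w.getD (n + 1 + 2 * es.length + 1) 0 = p.2)
    (hlen : es.length + k + 2 ≤ n) (hW : 4 * n ≤ W) :
    Halts W edgeBody s 50 fun s' => EdgeInv D w (es ++ [p]) s' ∧ s'.reg 1 = k ∧
      s'.reg 2 = n + 1 + 2 * (es ++ [p]).length := by
  have hm1 : s.mem (n + 1 + 2 * es.length) = p.1 := by rw [hs.mem_rest _ (by omega), h1]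
  have hm2 : s.mem (n + 1 + 2 * es.length + 1) = p.2 := by rw [hs.mem_rest _ (by omega), h2]
  have hp1 := p.1.2
  have hp2 := p.2.2
  have hc1 := cell_le D es p.1
  have hc2 := cell_le D es p.2
  have hm := hs.mem_cell
  let R : State → Prop := fun s' => EdgeInv D w (es ++ [p]) s' ∧ s'.reg 1 = k + 1 ∧
    s'.reg 2 = n + 1 + 2 * es.length
  -- The state once the cell addresses of both ends are in registers 4 and 5.
  set s₀ : State := ⟨Function.update (Function.update s.reg 4 (p.1 + 1)) 5 (p.2 + 1), s.mem⟩
    with hs₀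
  have h0 : EdgeInv D w es s₀ := by
    refine ⟨?_, ?_, ?_, ?_, ?_, ?_, ?_, ?_⟩
    · simp [hs₀, hs.reg_zero]
    · simp [hs₀, hs.reg_six]
    · simp [hs₀, hs.reg_seven]
    · simp [hs₀, hs.flag_le]
    · simpa [hs₀] using hs.flag
    · exact hs.mem_zero
    · exact hs.mem_cell
    · exact hs.mem_rest
  have h01 : s₀.reg 1 = k + 1 := by simp [hs₀, hr1]
  have h02 : s₀.reg 2 = n + 1 + 2 * es.length := by simp [hs₀, hr2]
  have h04 : s₀.reg 4 = p.1 + 1 := by simp [hs₀]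
  have h05 : s₀.reg 5 = p.2 + 1 := by simp [hs₀]
  clear_value s₀
  have hm0 := h0.mem_cell
  have hflag : (p.1 ∈ D ∨ p.2 ∈ D) → (s₀.reg 3 = 0 ↔ ∀ q ∈ es ++ [p], q.1 ∈ D ∨ q.2 ∈ D) := by
    intro hp
    simp only [List.mem_append, List.mem_singleton, or_imp (c := _ ∨ _), forall_and, forall_eq,
      hp, and_true]
    exact h0.flag
  -- The two cases with exactly one end outside `D`: `v` is the only vertex whose count changes.
  have hincr : ∀ v : Fin n, v ∈ D →
      (∀ u, (u ∈ D ∧ ((p.1 = u ∧ p.2 ∉ D) ∨ (p.2 = u ∧ p.1 ∉ D))) ↔ u = v) →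
      (p.1 ∈ D ∨ p.2 ∈ D) → ∀ r, s₀.reg r = v + 1 → Halts W (incr r) s₀ 6 R := by
    intro v hv hu hp r hr
    have hcv := cell_le D es v
    have hv2 := v.2
    refine Halts.mono (Halts.store (R := R) ?_ ?_ ?_) (by simp [Expr.cost]) (fun _ h => h)
    · simp only [Expr.Fits, hr]; omega
    · simp only [Expr.Fits, Expr.eval, hr, hm0]; omega
    · simp only [Expr.eval, hr]
      refine ⟨⟨h0.reg_zero, h0.reg_six, h0.reg_seven, h0.flag_le, hflag hp, ?_, ?_, ?_⟩, h01, h02⟩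
      · simp [h0.mem_zero]
      · intro u
        rw [cell_append]
        simp only [hu]
        by_cases huv : u = v
        · simp [huv, hm0]
        · have : (u : ℕ) + 1 ≠ v + 1 := fun h => huv (Fin.ext (by omega))
          simp [huv, Function.update_of_ne this, hm0]
      · intro j hj
        have : j ≠ v + 1 := by omega
        simp only [Function.update_of_ne this]
        exact h0.mem_rest j hj
  have hcond : Halts W (.cond (.load (.reg 4)) (.cond (.load (.reg 5)) .skip (incr 4))
      (.cond (.load (.reg 5)) (incr 5) (.assign 3 (.const 1)))) s₀
      (3 + ((3 + (1 + 6)) + (3 + (6 + 2)))) R := by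
    have hfit1 : Expr.Fits W s₀ (.load (.reg 4)) := by
      simp only [Expr.Fits, Expr.eval, h04, hm0]; omega
    have hfit2 : Expr.Fits W s₀ (.load (.reg 5)) := by
      simp only [Expr.Fits, Expr.eval, h05, hm0]; omega
    refine Halts.cond hfit1 (fun h4 => Halts.cond hfit2 (fun h5 => ?_) fun h5 => ?_)
      (fun h4 => Halts.cond hfit2 (fun h5 => ?_) fun h5 => ?_)
    all_goals
      simp only [Expr.eval, h04, h05, hm0, cell_ne_zero, cell_eq_zero] at h4 h5
    · refine Halts.skip ⟨⟨h0.reg_zero, h0.reg_six, h0.reg_seven, h0.flag_le, hflag (.inl h4),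
        h0.mem_zero, ?_, h0.mem_rest⟩, h01, h02⟩
      intro u
      rw [cell_append]
      simp [hm0, h4, h5]
    · refine hincr p.1 h4 (fun u => ?_) (.inl h4) 4 h04
      constructor
      · rintro ⟨-, h | h⟩
        · exact h.1.symm
        · exact absurd h4 h.2
      · rintro rfl
        exact ⟨h4, .inl ⟨rfl, h5⟩⟩
    · refine hincr p.2 h5 (fun u => ?_) (.inr h5) 5 h05
      constructor
      · rintro ⟨-, h | h⟩
        · exact absurd h5 h.2
        · exact h.1.symm
      · rintro rfl
        exact ⟨h5, .inr ⟨rfl, h4⟩⟩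
    · refine Halts.assign (by simp only [Expr.Fits]; omega) ⟨⟨?_, ?_, ?_, ?_, ?_, h0.mem_zero, ?_,
        h0.mem_rest⟩, ?_, ?_⟩
      · simp [h0.reg_zero]
      · simp [h0.reg_six]
      · simp [h0.reg_seven]
      · simp [Expr.eval]
      · simp only [Expr.eval, Function.update_self, one_ne_zero, false_iff]
        intro h
        have := h p (by simp)
        tauto
      · intro u
        rw [cell_append, if_neg, hm0, add_zero]
        rintro ⟨hu, ⟨rfl, -⟩ | ⟨rfl, -⟩⟩
        · exact h4 hu
        · exact h5 hu
      · simp [h01]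
      · simp [h02]
  refine Halts.mono (C := 50)
    (Halts.seq (Halts.assign ?_ (Halts.seq (Halts.assign ?_ (Halts.seq
      (C₁ := 3 + ((3 + (1 + 6)) + (3 + (6 + 2)))) (C₂ := 8) ?_))))) (by simp [Expr.cost])
    (fun _ h => h)
  · simp only [Expr.Fits, Expr.eval, hr2, hm1]; omega
  · simp [Expr.Fits, Expr.eval, hr2, hm2]; omega
  · have e : (⟨Function.update (Function.update s.reg 4
        (Expr.eval s (.add (.load (.reg 2)) (.const 1)))) 5 (Expr.eval ⟨Function.update s.reg 4 (Expr.eval s (.add (.load (.reg 2)) (.const 1))), s.mem⟩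
          (.add (.load (.add (.reg 2) (.const 1))) (.const 1))), s.mem⟩ : State) = s₀ := by
      simp [hs₀, Expr.eval, hr2, hm1, hm2]
    rw [e]
    refine hcond.mono le_rfl ?_
    rintro s' ⟨hi, h1', h2'⟩
    refine Halts.mono (C := 8) (Halts.seq (Halts.assign ?_ (Halts.assign ?_ ?_)))
      (by simp [Expr.cost]) (fun _ h => h)
    rotate_left 2
    refine ⟨⟨?_, ?_, ?_, ?_, ?_, hi.mem_zero,
      hi.mem_cell, hi.mem_rest⟩, ?_, ?_⟩
    rotate_left 7
    · simp only [Expr.Fits, Expr.eval, h2']; omega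
    · simp [Expr.Fits, h1']; omega
    · simp [hi.reg_zero]
    · simp [hi.reg_six]
    · simp [hi.reg_seven]
    · simp [hi.flag_le]
    · simpa using hi.flag
    · simp [Expr.eval, h1']
    · simp [Expr.eval, h2']; omega

end Program

/-! ### The input word, both loops, and the running time -/

section Program

variable {n : ℕ}

theorem getD_append_cons {α : Type*} (l l' : List α) (a d : α) {k : ℕ} (hk : k = l.length) :
    (l ++ a :: l').getD k d = a := by
  subst hk
  simp

/-- The word that represents the set `D` and the list `es` of edges. -/
def word (D : Finset (Fin n)) (es : List (Fin n × Fin n)) : List ℕ :=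
  n :: (List.ofFn fun v : Fin n => if v ∈ D then 1 else 0) ++
      es.flatMap fun p => [(p.1 : ℕ), (p.2 : ℕ)]

theorem length_flatMap_pair (es : List (Fin n × Fin n)) :
    (es.flatMap fun p => [(p.1 : ℕ), (p.2 : ℕ)]).length = 2 * es.length := by
  simp [List.length_flatMap, mul_comm]

theorem word_getD_fst (D : Finset (Fin n)) (l l' : List (Fin n × Fin n)) (p : Fin n × Fin n) :
    (word D (l ++ p :: l')).getD (n + 1 + 2 * l.length) 0 = p.1 := by
  rw [word, List.flatMap_append, ← List.append_assoc, List.flatMap_cons]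
  refine getD_append_cons _ _ _ _ ?_
  simp only [List.length_append, length_flatMap_pair, List.length_cons, List.length_ofFn]

theorem word_getD_snd (D : Finset (Fin n)) (l l' : List (Fin n × Fin n)) (p : Fin n × Fin n) :
    (word D (l ++ p :: l')).getD (n + 1 + 2 * l.length + 1) 0 = p.2 := by
  have : word D (l ++ p :: l') = ((n :: (List.ofFn fun v : Fin n => if v ∈ D then 1 else 0) ++
      l.flatMap fun p => [(p.1 : ℕ), (p.2 : ℕ)]) ++ [(p.1 : ℕ)]) ++
      (p.2 : ℕ) :: l'.flatMap fun p => [(p.1 : ℕ), (p.2 : ℕ)] := by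
    simp [word]
  rw [this]
  refine getD_append_cons _ _ _ _ ?_
  simp only [List.length_append, length_flatMap_pair, List.length_cons, List.length_ofFn,
    List.length_nil]

theorem edgeInv_initState (D : Finset (Fin n)) (es : List (Fin n × Fin n)) (f : ℕ → ℕ)
    (h0 : f 0 = 0) (h3 : f 3 = 0) (h6 : f 6 = 0) (h7 : f 7 = 0) :
    EdgeInv D (word D es) [] ⟨f, (initState (word D es)).mem⟩ := by
  refine ⟨h0, h6, h7, by simp [h3], by simp [h3], by simp [initState, word], ?_, fun _ _ => rfl⟩
  intro v
  have hv : (v : ℕ) < (List.ofFn fun v : Fin n => if v ∈ D then 1 else 0).length := by simp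
  simp only [initState, word, List.cons_append, List.getD_cons_succ, cell, edgeCount,
    List.countP_nil]
  rw [List.getD_append _ _ _ _ hv, List.getD_eq_getElem _ _ hv]
  simp

theorem halts_edgeLoop {W : ℕ} {D : Finset (Fin n)} {es : List (Fin n × Fin n)} {s : State}
    (hs : EdgeInv D (word D es) [] s) (hr1 : s.reg 1 = es.length) (hr2 : s.reg 2 = n + 1)
    (hlen : es.length + 1 ≤ n) (hW : 4 * n ≤ W) :
    Halts W (.loop (.reg 1) edgeBody) s (es.length * 52 + 2) (EdgeInv D (word D es) es) := by
  -- The edge list is split into the processed part `l` and the `k` edges still to come.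
  let I : ℕ → State → Prop := fun k s => ∃ l l', es = l ++ l' ∧ l'.length = k ∧
    EdgeInv D (word D es) l s ∧ s.reg 1 = k ∧ s.reg 2 = n + 1 + 2 * l.length
  refine (Halts.loop (e := .reg 1) (C := 50) (I := I) ?_ ?_ es.length s
    ⟨[], es, rfl, rfl, hs, hr1, by simpa using hr2⟩).mono (by simp [Expr.cost]) ?_
  · rintro k s ⟨l, l', rfl, rfl, -, h1, -⟩
    rw [List.length_append] at hlen
    exact ⟨by simp only [Expr.Fits, h1]; omega, h1⟩
  · rintro k s ⟨l, l', he, hk, hi, h1, h2⟩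
    cases l' with
    | nil => simp at hk
    | cons p l' =>
      have hk' : l'.length = k := by simpa using hk
      rw [he, List.length_append, hk] at hlen
      refine (halts_edgeBody hi h1 h2 (he ▸ word_getD_fst D l l' p) (he ▸ word_getD_snd D l l' p)
        (by omega) hW).mono le_rfl ?_
      rintro s' ⟨hi', h1', h2'⟩
      exact ⟨l ++ [p], l', by simpa using he, hk', hi', h1', h2'⟩
  · rintro s ⟨l, l', he, hk, hi, -, -⟩
    rw [List.length_eq_zero_iff.1 hk, List.append_nil] at he
    exact he ▸ hi

theorem card_filter_le_and (q : Fin n → Prop) [DecidablePred q] {k : ℕ} (hk : k < n) :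
    (Finset.univ.filter fun v : Fin n => k ≤ v ∧ q v).card =
      (Finset.univ.filter fun v : Fin n => k + 1 ≤ v ∧ q v).card +
        if q ⟨k, hk⟩ then 1 else 0 := by
  split_ifs with h
  · rw [← Finset.card_insert_of_notMem (a := (⟨k, hk⟩ : Fin n)) (by simp)]
    congr 1
    ext v
    simp only [Finset.mem_filter, Finset.mem_univ, true_and, Finset.mem_insert, Fin.ext_iff]
    constructor
    · rintro ⟨h1, h2⟩
      by_cases hv : (v : ℕ) = k
      · exact .inl hv
      · exact .inr ⟨by omega, h2⟩
    · rintro (h1 | ⟨h1, h2⟩)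
      · exact ⟨h1.ge, by rwa [show v = ⟨k, hk⟩ from Fin.ext h1]⟩
      · exact ⟨by omega, h2⟩
  · rw [add_zero]
    congr 1
    ext v
    simp only [Finset.mem_filter, Finset.mem_univ, true_and]
    refine and_congr_left fun hv => ⟨fun h1 => ?_, fun h1 => by omega⟩
    by_contra h2
    exact h (by rwa [show v = ⟨k, hk⟩ from Fin.ext (by simp only; omega)] at hv)

theorem forall_le_and_iff (q : Fin n → Prop) {k : ℕ} (hk : k < n) :
    (∀ v : Fin n, k ≤ v → q v) ↔ (∀ v : Fin n, k + 1 ≤ v → q v) ∧ q ⟨k, hk⟩ := by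
  constructor
  · exact fun h => ⟨fun v hv => h v (by omega), h _ le_rfl⟩
  · rintro ⟨h1, h2⟩ v hv
    by_cases hvk : (v : ℕ) = k
    · rwa [show v = ⟨k, hk⟩ from Fin.ext hvk]
    · exact h1 v (by omega)

/-- The situation when the vertices `v ≥ k` have been processed. -/
structure VertexInv (D : Finset (Fin n)) (es : List (Fin n × Fin n)) (k : ℕ) (s : State) :
    Prop where
  le : k ≤ n
  reg_zero : s.reg 0 = 0
  reg_one : s.reg 1 = k
  reg_six : s.reg 6 = (Finset.univ.filter fun v : Fin n => k ≤ v ∧ v ∉ D).card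
  reg_seven : s.reg 7 =
    (Finset.univ.filter fun v : Fin n => k ≤ v ∧ v ∈ D ∧ edgeCount D es v = 2).card
  flag_le : s.reg 3 ≤ 1
  flag : s.reg 3 = 0 ↔ (∀ p ∈ es, p.1 ∈ D ∨ p.2 ∈ D) ∧
    ∀ v : Fin n, k ≤ v → v ∈ D → edgeCount D es v = 0 ∨ edgeCount D es v = 2
  mem_cell : ∀ v : Fin n, s.mem (v + 1) = cell D es v

theorem card_filter_fin_le (q : Fin n → Prop) [DecidablePred q] :
    (Finset.univ.filter q).card ≤ n :=
  (Finset.card_le_univ _).trans (by simp)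

theorem halts_vertexBody {W : ℕ} {D : Finset (Fin n)} {es : List (Fin n × Fin n)} {k : ℕ}
    {s : State} (hs : VertexInv D es (k + 1) s) (hlen : es.length + 1 ≤ n) (hW : 4 * n ≤ W) :
    Halts W vertexBody s 50 (VertexInv D es k) := by
  have hk : k < n := hs.le
  set v : Fin n := ⟨k, hk⟩ with hv
  have hm : s.mem (k + 1) = cell D es v := hs.mem_cell v
  have hc := cell_le D es v
  have h1 := hs.reg_one
  have h6 := card_filter_fin_le fun v : Fin n => k + 1 ≤ v ∧ v ∉ D
  rw [← hs.reg_six] at h6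
  have h7 := card_filter_fin_le fun v : Fin n => k + 1 ≤ v ∧ v ∈ D ∧ edgeCount D es v = 2
  rw [← hs.reg_seven] at h7
  have e6 := card_filter_le_and (fun v => v ∉ D) hk
  have e7 := card_filter_le_and (fun v => v ∈ D ∧ edgeCount D es v = 2) hk
  rw [← hs.reg_six] at e6
  rw [← hs.reg_seven] at e7
  -- The condition recorded by the flag for `k` is the one for `k + 1` together with the condition
  -- at vertex `k`.
  have e3 := and_congr_right_iff.2 fun (_ : ∀ p ∈ es, p.1 ∈ D ∨ p.2 ∈ D) =>
    forall_le_and_iff (fun v => v ∈ D → edgeCount D es v = 0 ∨ edgeCount D es v = 2) hk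
  rw [← and_assoc, ← hs.flag] at e3
  rw [← hv] at e3 e6 e7
  let R : State → Prop := fun s' => s'.mem = s.mem ∧ s'.reg 0 = 0 ∧ s'.reg 1 = k + 1 ∧
    s'.reg 6 = (s.reg 6 + if v ∉ D then 1 else 0) ∧
    s'.reg 7 = (s.reg 7 + if v ∈ D ∧ edgeCount D es v = 2 then 1 else 0) ∧
    s'.reg 3 ≤ 1 ∧ (s'.reg 3 = 0 ↔ s.reg 3 = 0 ∧
      (v ∈ D → edgeCount D es v = 0 ∨ edgeCount D es v = 2))
  have hcond : Halts W (.cond (.reg 4)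
      (.cond (.sub (.reg 4) (.const 1))
        (.cond (.add (.sub (.reg 4) (.const 3)) (.sub (.const 3) (.reg 4)))
          (.assign 3 (.const 1))
          (.assign 7 (.add (.reg 7) (.const 1))))
        .skip)
      (.assign 6 (.add (.reg 6) (.const 1))))
      ⟨Function.update s.reg 4 (cell D es v), s.mem⟩ 29 R := by
    have hfit : ∀ j, j ≤ 3 → Expr.Fits W
        ⟨Function.update s.reg 4 (cell D es v), s.mem⟩ (.sub (.reg 4) (.const j)) := by
      intro j hj
      simp only [Expr.Fits, Function.update_self]; omega
    have hcell : v ∈ D → cell D es v = edgeCount D es v + 1 := fun h => if_pos h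
    refine Halts.mono (C := 29) (Halts.cond ?_
      (fun h => Halts.cond (hfit 1 (by norm_num)) (fun h' => Halts.cond ?_
        (fun h'' => Halts.assign ?_ ?_) (fun h'' => Halts.assign ?_ ?_)) (fun h' => Halts.skip ?_))
      (fun h => Halts.assign ?_ ?_)) (by simp [Expr.cost]) (fun _ h => h)
    · simp only [Expr.Fits, Function.update_self]; omega
    · refine ⟨hfit 3 le_rfl, ?_, ?_⟩
      · simp only [Expr.Fits, Function.update_self]; omega
      · simp only [Expr.eval, Function.update_self]; omega
    · simp only [Expr.Fits]; omega
    · simp only [Expr.eval, Function.update_self, cell_ne_zero] at h h' h''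
      rw [hcell h] at h' h''
      have h2 : edgeCount D es v ≠ 2 := by omega
      have h0 : edgeCount D es v ≠ 0 := by omega
      refine ⟨rfl, ?_, ?_, ?_, ?_, ?_, ?_⟩
      · simp [hs.reg_zero]
      · simp [h1]
      · simp [h]
      · simp [h2]
      · simp [Expr.eval]
      · simp [Expr.eval, h, h0, h2]
    · simp [Expr.Fits, Expr.eval]; omega
    · simp only [Expr.eval, Function.update_self, cell_ne_zero] at h h' h''
      rw [hcell h] at h''
      have h2 : edgeCount D es v = 2 := by omega
      refine ⟨rfl, ?_, ?_, ?_, ?_, ?_, ?_⟩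
      · simp [hs.reg_zero]
      · simp [h1]
      · simp [h]
      · simp [Expr.eval, h, h2]
      · simp [hs.flag_le]
      · simp [h2]
    · simp only [Expr.eval, Function.update_self, cell_ne_zero] at h h'
      rw [hcell h] at h'
      have h0 : edgeCount D es v = 0 := by omega
      refine ⟨rfl, ?_, ?_, ?_, ?_, ?_, ?_⟩
      · simp [hs.reg_zero]
      · simp [h1]
      · simp [h]
      · simp [h0]
      · simp [hs.flag_le]
      · simp [h0]
    · simp [Expr.Fits, Expr.eval]; omega
    · simp only [Expr.eval, Function.update_self, cell_eq_zero] at h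
      refine ⟨rfl, ?_, ?_, ?_, ?_, ?_, ?_⟩
      · simp [hs.reg_zero]
      · simp [h1]
      · simp [Expr.eval, h]
      · simp [h]
      · simp [hs.flag_le]
      · simp [h]
  refine Halts.mono (C := 50) (Halts.seq (Halts.assign ?_ (Halts.seq (C₁ := 29) (C₂ := 4) ?_)))
    (by simp [Expr.cost]) (fun _ h => h)
  · simp only [Expr.Fits, Expr.eval, h1, hm]; omega
  · have e : Expr.eval s (.load (.reg 1)) = cell D es v := by simp only [Expr.eval, h1, hm]
    rw [e]
    refine hcond.mono le_rfl ?_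
    rintro s' ⟨hmem, h0', h1', h6', h7', h3', hf'⟩
    refine Halts.assign ?_ ⟨hk.le, ?_, ?_, ?_, ?_, ?_, ?_, ?_⟩
    · simp only [Expr.Fits, h1']; omega
    · simp [h0']
    · simp [Expr.eval, h1']
    · simp [h6', e6]
    · simp [h7', e7]
    · simp [h3']
    · rw [e3]; simpa using hf'
    · exact hmem ▸ hs.mem_cell

theorem halts_vertexLoop {W : ℕ} {D : Finset (Fin n)} {es : List (Fin n × Fin n)} {s : State}
    (hs : VertexInv D es n s) (hlen : es.length + 1 ≤ n) (hW : 4 * n ≤ W) :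
    Halts W (.loop (.reg 1) vertexBody) s (n * 52 + 2) (VertexInv D es 0) := by
  refine (Halts.loop (e := .reg 1) (C := 50) (I := VertexInv D es) ?_
    (fun k s hs => halts_vertexBody hs hlen hW) n s hs).mono (by simp [Expr.cost]) (fun _ h => h)
  intro k s hs
  have := hs.le
  have h1 := hs.reg_one
  exact ⟨by simp only [Expr.Fits, h1]; omega, h1⟩

/-- The test that the program carries out. -/
def ListTest (D : Finset (Fin n)) (es : List (Fin n × Fin n)) : Prop :=
  (∀ p ∈ es, p.1 ∈ D ∨ p.2 ∈ D) ∧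
    (∀ v : Fin n, v ∈ D → edgeCount D es v = 0 ∨ edgeCount D es v = 2) ∧
    (Finset.univ.filter fun v : Fin n => v ∉ D).card =
      (Finset.univ.filter fun v : Fin n => v ∈ D ∧ edgeCount D es v = 2).card + 1

theorem halts_criticalProg {W : ℕ} {D : Finset (Fin n)} {es : List (Fin n × Fin n)}
    (hlen : es.length + 1 = n) (hW : 4 * n ≤ W) :
    Halts W criticalProg (initState (word D es)) (200 * n) fun s =>
      (ListTest D es → s.reg 0 = 1) ∧ (¬ ListTest D es → s.reg 0 = 0) := by
  have hm : (initState (word D es)).mem 0 = n := by simp [initState, word]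
  refine Halts.mono (Halts.seq (Halts.assign ?_ (Halts.seq (Halts.assign ?_ (Halts.seq
    (C₁ := es.length * 52 + 2) (C₂ := 3 + (n * 52 + 2 + 18)) ?_))))) (C := 200 * n) ?_
    (fun _ h => h)
  · simp only [Expr.Fits, Expr.eval, hm]; omega
  · simp only [Expr.Fits, Expr.eval, hm]; omega
  · refine (halts_edgeLoop (edgeInv_initState D es _ ?_ ?_ ?_ ?_) ?_ ?_ hlen.le hW).mono le_rfl ?_
    · simp [initState]
    · simp [initState]
    · simp [initState]
    · simp [initState]
    · simp [Expr.eval, hm]; omega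
    · simp [Expr.eval, hm]
    intro s hs
    refine Halts.seq (Halts.assign ?_
      (Halts.seq ((halts_vertexLoop (D := D) ?_ hlen.le hW).mono le_rfl ?_)))
    · simp only [Expr.Fits, Expr.eval, hs.mem_zero]; omega
    · have hempty : ∀ v : Fin n, ¬ n ≤ v := fun v => v.2.not_ge
      refine ⟨le_rfl, ?_, ?_, ?_, ?_, ?_, ?_, hs.mem_cell⟩
      · simp [hs.reg_zero]
      · simp [Expr.eval, hs.mem_zero]
      · simp [hs.reg_six, hempty]
      · simp [hs.reg_seven, hempty]
      · simp [hs.flag_le]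
      · have : ∀ v : Fin n, n ≤ v → v ∈ D → edgeCount D es v = 0 ∨ edgeCount D es v = 2 :=
          fun v hv => absurd v.2 hv.not_gt
        simpa [this] using hs.flag
    intro s hs
    have h0 := hs.reg_zero
    have h3 := hs.flag
    have h3' := hs.flag_le
    have h6 := hs.reg_six
    have h7 := hs.reg_seven
    simp only [zero_le, true_and, true_imp_iff] at h3 h6 h7
    have h6' := card_filter_fin_le fun v : Fin n => v ∉ D
    have h7' := card_filter_fin_le fun v : Fin n => v ∈ D ∧ edgeCount D es v = 2
    have htest : ListTest D es ↔ s.reg 3 = 0 ∧ s.reg 6 = s.reg 7 + 1 := by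
      rw [h3, h6, h7, ListTest, and_assoc]
    rw [← h6] at h6'
    rw [← h7] at h7'
    simp only [htest]
    refine (Halts.cond ?_ (fun h => Halts.skip ?_) (fun h => Halts.cond ?_
      (fun h' => Halts.skip ?_) (fun h' => Halts.assign ?_ ?_))).mono (by simp [Expr.cost])
      (fun _ h => h)
    · simp only [Expr.Fits]; omega
    · simp only [Expr.eval] at h
      exact ⟨fun h' => absurd h'.1 h, fun _ => h0⟩
    · simp only [Expr.Fits, Expr.eval]; omega
    · simp only [Expr.eval] at h'
      exact ⟨fun h => by omega, fun _ => h0⟩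
    · simp only [Expr.Fits]; omega
    · simp only [Expr.eval] at h h'
      refine ⟨fun _ => by simp [Expr.eval], fun hn => absurd ⟨?_, ?_⟩ hn⟩
      · simpa using h
      · omega
  · simp only [Expr.cost]; omega

end Program

/-! ### The list of edges against the graph -/

section Correctness

variable {n : ℕ} {T : SimpleGraph (Fin n)} {D : Finset (Fin n)} {es : List (Fin n × Fin n)}

theorem edgeCount_eq_outDegree [DecidableRel T.Adj]
    (hnd : (es.map fun p => s(p.1, p.2)).Nodup)
    (hmem : ∀ e : Sym2 (Fin n), e ∈ es.map (fun p => s(p.1, p.2)) ↔ e ∈ T.edgeSet)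
    {v : Fin n} (hv : v ∈ D) : edgeCount D es v = outDegree T D v := by
  have hadj : ∀ p ∈ es, T.Adj p.1 p.2 := fun p hp =>
    (hmem s(p.1, p.2)).1 (List.mem_map.2 ⟨p, hp, rfl⟩)
  rw [edgeCount, outDegree, List.countP_eq_length_filter,
    ← List.toFinset_card_of_nodup (hnd.of_map.filter _)]
  -- An edge at `v` is sent to its other end; this is injective since the list contains each edge
  -- only once.
  refine Finset.card_bij (fun p _ => if p.1 = v then p.2 else p.1) ?_ ?_ ?_
  · intro p hp
    simp only [List.mem_toFinset, List.mem_filter, decide_eq_true_eq] at hp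
    have := hadj p hp.1
    rcases hp.2 with ⟨rfl, h⟩ | ⟨rfl, h⟩
    · simpa [h] using this.symm
    · simpa [h, this.ne] using this
  · intro p hp q hq hpq
    simp only [List.mem_toFinset, List.mem_filter, decide_eq_true_eq] at hp hq
    have key : ∀ p : Fin n × Fin n, ((p.1 = v ∧ p.2 ∉ D) ∨ (p.2 = v ∧ p.1 ∉ D)) →
        s(p.1, p.2) = s(v, if p.1 = v then p.2 else p.1) := by
      rintro ⟨a, b⟩ (⟨rfl, h⟩ | ⟨rfl, h⟩)
      · simp
      · have : a ≠ b := fun e => h (e ▸ hv)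
        simp [this, Sym2.eq_swap]
    refine List.inj_on_of_nodup_map hnd hp.1 hq.1 ?_
    rw [key p hp.2, key q hq.2, hpq]
  · intro x hx
    simp only [Finset.mem_filter, Finset.mem_compl] at hx
    obtain ⟨p, hp, h⟩ := List.mem_map.1 ((hmem s(x, v)).2 hx.2)
    have hxv := hx.2.ne
    refine ⟨p, ?_, ?_⟩
    · simp only [List.mem_toFinset, List.mem_filter, decide_eq_true_eq]
      rcases Sym2.eq_iff.1 h with ⟨h1, h2⟩ | ⟨h1, h2⟩
      · exact ⟨hp, .inr ⟨h2, h1 ▸ hx.1⟩⟩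
      · exact ⟨hp, .inl ⟨h1, h2 ▸ hx.1⟩⟩
    · rcases Sym2.eq_iff.1 h with ⟨h1, h2⟩ | ⟨h1, h2⟩
      · rw [h1, h2, if_neg hxv]
      · rw [h1, h2, if_pos rfl]

theorem listTest_iff_countTest [DecidableRel T.Adj]
    (hnd : (es.map fun p => s(p.1, p.2)).Nodup)
    (hmem : ∀ e : Sym2 (Fin n), e ∈ es.map (fun p => s(p.1, p.2)) ↔ e ∈ T.edgeSet) :
    ListTest D es ↔ CountTest T D := by
  have hdeg : ∀ v ∈ D, edgeCount D es v = outDegree T D v := fun v hv =>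
    edgeCount_eq_outDegree hnd hmem hv
  have h1 : (∀ p ∈ es, p.1 ∈ D ∨ p.2 ∈ D) ↔ ∀ x y, x ∉ D → y ∉ D → ¬ T.Adj x y := by
    constructor
    · intro h x y hx hy hxy
      obtain ⟨p, hp, e⟩ := List.mem_map.1 ((hmem s(x, y)).2 hxy)
      have := h p hp
      rcases Sym2.eq_iff.1 e with ⟨h1, h2⟩ | ⟨h1, h2⟩ <;> rw [h1, h2] at this <;> tauto
    · intro h p hp
      have : T.Adj p.1 p.2 := (hmem s(p.1, p.2)).1 (List.mem_map.2 ⟨p, hp, rfl⟩)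
      by_contra! hD
      exact h _ _ hD.1 hD.2 this
  have h2 : (∀ v, v ∈ D → edgeCount D es v = 0 ∨ edgeCount D es v = 2) ↔
      ∀ v ∈ D, outDegree T D v = 0 ∨ outDegree T D v = 2 :=
    forall₂_congr fun v hv => by rw [hdeg v hv]
  have h3 : (Finset.univ.filter fun v : Fin n => v ∉ D) = Dᶜ := by ext; simp
  have h4 : (Finset.univ.filter fun v : Fin n => v ∈ D ∧ edgeCount D es v = 2) =
      D.filter fun v => outDegree T D v = 2 := by
    ext v
    simp only [Finset.mem_filter, Finset.mem_univ, true_and]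
    exact and_congr_right fun hv => by rw [hdeg v hv]
  rw [ListTest, h1, h2, h3, h4]
  exact ⟨fun h => ⟨h.1, h.2.1, h.2.2⟩, fun h => ⟨h.1, h.2, h.3⟩⟩

theorem length_add_one_of_isTree (hT : T.IsTree)
    (hnd : (es.map fun p => s(p.1, p.2)).Nodup)
    (hmem : ∀ e : Sym2 (Fin n), e ∈ es.map (fun p => s(p.1, p.2)) ↔ e ∈ T.edgeSet) :
    es.length + 1 = n := by
  classical
  have h := hT.card_edgeFinset
  rw [Fintype.card_fin] at h
  have : T.edgeFinset = (es.map fun p => s(p.1, p.2)).toFinset := by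
    ext e
    rw [SimpleGraph.mem_edgeFinset, List.mem_toFinset, hmem]
  rwa [this, List.toFinset_card_of_nodup hnd, List.length_map] at h

theorem decidesCriticalTreesInLinearTime_criticalProg :
    DecidesCriticalTreesInLinearTime criticalProg := by
  classical
  -- The constant 200 serves as time bound and as word bound; the latter needs only 4n, which covers
  -- addresses, counts and the constant 3 as n ≥ 1.
  refine ⟨200, fun n T D w hT ⟨es, hnd, hmem, hw⟩ => ?_⟩
  have hw : w = word D es := hw
  obtain ⟨t, s, hx, ht, h1, h2⟩ := halts_criticalProg (W := 200 * n) (D := D)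
    (length_add_one_of_isTree hT hnd hmem) (by omega)
  rw [listTest_iff_countTest hnd hmem, ← critical_iff_countTest hT.isAcyclic] at h1 h2
  exact ⟨t, s, hw ▸ hx, ht, h1, h2⟩

end Correctness

end MBD

theorem mainTheorem5 :
    (∃ P : MBD.Prog, MBD.DecidesCriticalTreesInLinearTime P) ∧
    (∀ (V : Type*) [Fintype V] [DecidableEq V] (T : SimpleGraph V) (D : Finset V), T.IsTree →
      (MBD.Critical T D ↔ MBD.PassesTest T D)) :=
  ⟨⟨MBD.criticalProg, MBD.decidesCriticalTreesInLinearTime_criticalProg⟩,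
    fun _ _ _ _ _ hT => MBD.critical_iff_passesTest hT.isAcyclic⟩
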